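/- Let $\mathbb T^2=(\mathbb R/2\pi\mathbb Z)^2$ and, for $u\in L^2(\mathbb T^2)$ and $\xi\in\mathbb Z^2$, let $\hat u(\xi)=(2\pi)^{-2}\int_{\mathbb T^2}e^{-i\xi_1x-i\xi_2y}u(x,y)\,dx\,dy$ and $\|u\|_{H^s(\mathbb T^2)}^2=(2\pi)^2\sum_{\xi\in\mathbb Z^2}(1+|\xi|^2)^s|\hat u(\xi)|^2$. Let $\Lambda$ be given by $\widehat{\Lambda u}(\xi)=|\xi|\hat u(\xi)$, and let $H^2_{\mathrm{od}}(\mathbb T^2)$ be the set of real-valued $u\in H^2(\mathbb T^2)$ that are odd in $x$, i.e. $u(-x,y)=-u(x,y)$. Let $\epsilon>0$, $\delta\ge 0$, $\beta>0$. For $\eta_0\in H^2_{\mathrm{od}}(\mathbb T^2)$ consider the initial value problem $$\eta_t+\eta\eta_x+(\beta-1)\eta_{xx}-\eta_{yy}-\delta\Lambda^3\eta+\epsilon\Delta^2\eta=0\ \text{ on }\mathbb T^2\times(0,\infty),\qquad \eta(\cdot,\cdot,0)=\eta_0, \qquad (1)$$ whose solutions are understood in the class of those $\eta$ with $\eta\in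 C([0,T];H^2(\mathbb T^2))\cap L^2(0,T;H^4(\mathbb T^2))$ for every $T>0$. Then there are constants $R_1$ and $R_2=R'_{\epsilon,\delta,\beta}$, which depend only on $\epsilon,\delta,\beta$, such that: (a) for every $\eta_0\in H^2_{\mathrm{od}}(\mathbb T^2)$, the solution $\eta$ of (1) satisfies $$\limsup_{t\to\infty}\|\eta(t)\|_{H^2(\mathbb T^2)}\le R'_{\epsilon,\delta,\beta};$$ (b) for $s=1$ and $s=2$, the ball $\{\|u\|_{H^s}\le R_s\}$ is absorbing in $H^s$ for data in $H^2_{\mathrm{od}}(\mathbb T^2)$: for every $M\ge0$ there is $T\ge 0$ such that, for every $\eta_0\in H^2_{\mathrm{od}}(\mathbb T^2)$ with $\|\eta_0\|_{H^s}\le M$, the solution $\eta$ of (1) satisfies $\|\eta(t)\|_{H^s}\le R_s$ for all $t\ge T$. -/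

import Mathlib

open MeasureTheory Filter Topology
open scoped ENNReal NNReal

noncomputable section

namespace NonlocalKS

instance fact_two_pi_pos : Fact (0 < 2 * Real.pi) := ⟨Real.two_pi_pos⟩

/-- The torus `𝕋² = (ℝ / 2πℤ)²`, with its Lebesgue measure `volume` of total mass `(2π)²`. -/
abbrev Torus : Type := AddCircle (2 * Real.pi) × AddCircle (2 * Real.pi)

/-- The Fourier coefficient
`û(ξ) = (2π)⁻² ∫_{𝕋²} e^{-i ξ₁ x - i ξ₂ y} u(x, y) dx dy`, `ξ = (ξ₁, ξ₂) ∈ ℤ²`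
(on `AddCircle (2π)` the function `fourier n` is `x ↦ e^{i n x}`). -/
def fourierCoef (u : Torus → ℝ) (ξ : ℤ × ℤ) : ℂ :=
  (((2 * Real.pi) ^ 2 : ℝ) : ℂ)⁻¹ *
    ∫ z : Torus, fourier (-ξ.1) z.1 * fourier (-ξ.2) z.2 * (u z : ℂ)

/-- `|ξ|² = ξ₁² + ξ₂²`. -/
def freqSq (ξ : ℤ × ℤ) : ℝ := (ξ.1 : ℝ) ^ 2 + (ξ.2 : ℝ) ^ 2

/-- The norm of the Sobolev space `H^s(𝕋²)`, with values in `[0, ∞]`: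
`‖u‖_{H^s}² = (2π)² ∑_{ξ ∈ ℤ²} (1 + |ξ|²)^s |û(ξ)|²`.
For `s = 0` and `u ∈ L²(𝕋²)` this is the `L²` norm. -/
def sobolevNorm (s : ℕ) (u : Torus → ℝ) : ℝ≥0∞ :=
  (ENNReal.ofReal ((2 * Real.pi) ^ 2) *
    ∑' ξ : ℤ × ℤ, ENNReal.ofReal ((1 + freqSq ξ) ^ s) * ‖fourierCoef u ξ‖ₑ ^ 2) ^ (1 / 2 : ℝ)

/-- `u ∈ H^s(𝕋²)`: `u` is square integrable and has a finite `H^s` norm. -/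
def MemSobolev (s : ℕ) (u : Torus → ℝ) : Prop :=
  MemLp u 2 volume ∧ sobolevNorm s u < ∞

/-- `u ∈ H²_od(𝕋²)`: `u ∈ H²(𝕋²)` and `u` is odd in `x`, that is, `u(-x, y) = -u(x, y)`. The
identity is asked almost everywhere, since elements of `H²` are classes of functions; the continuous
representative then satisfies it everywhere. -/
def MemH2Odd (u : Torus → ℝ) : Prop :=
  MemSobolev 2 u ∧ ∀ᵐ z : Torus ∂volume, u (-z.1, z.2) = -u z

/-- The Fourier symbol of the linear operator `(β - 1) ∂ₓₓ - ∂_yy - δ Λ³ + ε Δ²`, where `Λ` is the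
Fourier multiplier with symbol `|ξ|`. -/
def linearSymbol (ε δ β : ℝ) (ξ : ℤ × ℤ) : ℝ :=
  (β - 1) * (-(ξ.1 : ℝ) ^ 2) - (-(ξ.2 : ℝ) ^ 2) - δ * (Real.sqrt (freqSq ξ)) ^ 3
    + ε * (freqSq ξ) ^ 2

/-- `η` is a (global, strong) solution of
`η_t + η η_x + (β - 1) η_xx - η_yy - δ Λ³ η + ε Δ² η = 0` on `𝕋² × (0, ∞)`, `η(·, ·, 0) = η₀`, in the
class `C([0, T]; H²(𝕋²)) ∩ L²(0, T; H⁴(𝕋²))` for every `T > 0`. -/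
structure IsSolution (ε δ β : ℝ) (η₀ : Torus → ℝ) (η : ℝ → Torus → ℝ) : Prop where
  /-- `η(t) ∈ H²` for all `t ≥ 0` -/
  mem_H2 : ∀ t : ℝ, 0 ≤ t → MemSobolev 2 (η t)
  /-- `η` is continuous from `[0, ∞)` to `H²` -/
  continuous_H2 : ∀ t : ℝ, 0 ≤ t →
    Tendsto (fun s : ℝ => sobolevNorm 2 (η s - η t)) (𝓝[Set.Ici 0] t) (𝓝 0)
  /-- `η ∈ L²(0, T; H⁴)` for all `T > 0` -/
  mem_L2_H4 : ∀ T : ℝ, 0 < T → ∫⁻ t in Set.Ioc 0 T, sobolevNorm 4 (η t) ^ 2 < ∞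
  /-- the initial condition, as an identity in `L²(𝕋²)` -/
  initial : η 0 =ᵐ[volume] η₀
  /-- The equation at every time `t > 0`, in the sense of distributions on `𝕋²` (it is tested with
  each character `e^{-i ξ · z}`), with `η η_x = (η² / 2)_x`. -/
  equation : ∀ ξ : ℤ × ℤ, ∀ t : ℝ, 0 < t →
    HasDerivAt (fun s : ℝ => fourierCoef (η s) ξ)
      (-(Complex.I * (ξ.1 : ℂ) * fourierCoef (fun z => η t z ^ 2 / 2) ξ
        + (linearSymbol ε δ β ξ : ℂ) * fourierCoef (η t) ξ)) t

/-- The closed ball of radius `R` about `0` in the `H^s` norm is an absorbing set for the solutions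
with data in `H²_od(𝕋²)`: every set of data which is bounded in `H^s` enters it
after a time that depends on the set only, and stays there. -/
def BallIsAbsorbing (ε δ β : ℝ) (s : ℕ) (R : ℝ≥0) : Prop :=
  ∀ M : ℝ≥0, ∃ T : ℝ, ∀ (η₀ : Torus → ℝ) (η : ℝ → Torus → ℝ),
    MemH2Odd η₀ → IsSolution ε δ β η₀ η → sobolevNorm s η₀ ≤ M →
      ∀ t : ℝ, 0 ≤ t → T ≤ t → sobolevNorm s (η t) ≤ R

end NonlocalKS

end

/-!
Absorbing sets for the nonlocal Kuramoto–Sivashinsky equation on the torus, for odd data. The whole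
argument takes place on the Fourier coefficients `a t ξ` of the solution, which satisfy the system
`a' = -(i ξ₁ N(a) + ℓ a)` (`ModeSystem`), where `N(a)` is half the convolution square of `a` and the
symbol satisfies `ℓ ξ ≥ (ε / 2) (1 + |ξ|²)² - C`. The passage from functions to this system
(`IsSolution.modeSystem`) needs the convolution theorem, hence the completeness of the characters.

*Smoothing.* For a single mode, a bound of `a` and of `N(a)` on a time interval improves, after a
waiting time, by powers of `1 + |ξ|²`, because `|a ξ|²` satisfies a scalar linear differential
inequality (`ModeSystem.exists_mode_decay`). Three such steps lead from an `L²` bound, which bounds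
`N(a)` pointwise, to `|a ξ|² ≤ C (1 + |ξ|²)⁻⁵`, and this bounds the `H²` norm
(`ModeSystem.exists_decay_of_energy_le`). It therefore suffices to find an absorbing ball in `L²`,
and the same ball of `H²` serves for data bounded in `H¹` and in `H²`. The same lemma, with
constants that depend on the solution, justifies all termwise differentiations at positive times.

*Oddness.* A solution is not assumed to be odd at positive times; its even part satisfies a linear
equation with zero data, so that an energy estimate makes it vanish (`ModeSystem.odd`).

*The `L²` bound* (`ModeSystem.exists_energy_decay`) is the background flow method. For a function
`φ(x)`, the derivative of `‖u‖² / 2 - ∫ φ u` contains `-∫ φ' u² / 2`, while the transport term drops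
out (`tsum_transport_eq_zero`). With `φ' = λ (1 - F)`, `F` a Fejér kernel of mean one, the constant
`λ` overcomes the finitely many unstable modes. Since `u` vanishes at `x = 0`, where `F`
concentrates, `∫ F u²` is at most a small multiple of `‖u‖²_{H²}`: in Fourier variables `∫ F u²` is
`1 / n` times the sum of the squares of the sums of `a` over windows of length `n` in `ξ₁`, and for
odd `u` that sum of squares is bounded independently of `n` (`exists_tsum_windowSum_le`).
-/

noncomputable section

namespace NonlocalKS

/-! ### Weights on the lattice -/

/-- The weight `1 + |ξ|²` of the Sobolev norms. -/
def wt (ξ : ℤ × ℤ) : ℝ := 1 + freqSq ξ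

lemma one_le_wt (ξ : ℤ × ℤ) : 1 ≤ wt ξ := by
  unfold wt freqSq; nlinarith [sq_nonneg (ξ.1 : ℝ), sq_nonneg (ξ.2 : ℝ)]

lemma wt_pos (ξ : ℤ × ℤ) : 0 < wt ξ := zero_lt_one.trans_le (one_le_wt ξ)

/-- The reflection `(ξ₁, ξ₂) ↦ (-ξ₁, ξ₂)` of frequencies, which corresponds to `x ↦ -x`. -/
def reflect : (ℤ × ℤ) ≃+ (ℤ × ℤ) where
  toFun ξ := (-ξ.1, ξ.2)
  invFun ξ := (-ξ.1, ξ.2)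
  left_inv ξ := by simp
  right_inv ξ := by simp
  map_add' ξ μ := by ext <;> simp [add_comm]

@[simp] lemma reflect_fst (ξ : ℤ × ℤ) : (reflect ξ).1 = -ξ.1 := rfl
@[simp] lemma reflect_snd (ξ : ℤ × ℤ) : (reflect ξ).2 = ξ.2 := rfl
@[simp] lemma reflect_reflect (ξ : ℤ × ℤ) : reflect (reflect ξ) = ξ := by ext <;> simp

lemma wt_reflect (ξ : ℤ × ℤ) : wt (reflect ξ) = wt ξ := by simp [wt, freqSq]

lemma wt_add_le (μ ν : ℤ × ℤ) : wt (μ + ν) ≤ 2 * (wt μ + wt ν) := by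
  simp only [wt, freqSq, Prod.fst_add, Prod.snd_add, Int.cast_add]
  nlinarith [sq_nonneg ((μ.1 : ℝ) - ν.1), sq_nonneg ((μ.2 : ℝ) - ν.2)]

lemma sq_fst_le_wt (ξ : ℤ × ℤ) : (ξ.1 : ℝ) ^ 2 ≤ wt ξ := by
  unfold wt freqSq; nlinarith [sq_nonneg (ξ.2 : ℝ)]

/-- The summable sequence `(1 + |ξ|²)^{-3/2}`, the standard majorant in what follows. -/
def decay (ξ : ℤ × ℤ) : ℝ := wt ξ ^ (-(3 / 2) : ℝ)

lemma decay_pos (ξ : ℤ × ℤ) : 0 < decay ξ := Real.rpow_pos_of_pos (wt_pos ξ) _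

lemma decay_le_one (ξ : ℤ × ℤ) : decay ξ ≤ 1 :=
  Real.rpow_le_one_of_one_le_of_nonpos (one_le_wt ξ) (by norm_num)

lemma decay_sq (ξ : ℤ × ℤ) : decay ξ ^ 2 = (wt ξ ^ 3)⁻¹ := by
  rw [decay, ← Real.rpow_natCast, ← Real.rpow_mul (wt_pos ξ).le, ← Real.rpow_natCast,
    ← Real.rpow_neg (wt_pos ξ).le]
  norm_num

lemma wt_mul_decay_le_one (ξ : ℤ × ℤ) : wt ξ * decay ξ ≤ 1 := by
  have h : (wt ξ * decay ξ) ^ 2 ≤ 1 := by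
    rw [mul_pow, decay_sq, ← div_eq_mul_inv, div_le_one (pow_pos (wt_pos ξ) 3)]
    exact pow_le_pow_right₀ (one_le_wt ξ) (by norm_num)
  nlinarith [mul_pos (wt_pos ξ) (decay_pos ξ)]

lemma summable_one_add_sq_rpow : Summable fun m : ℤ => (1 + (m : ℝ) ^ 2) ^ (-(3 / 4) : ℝ) := by
  have h1 : Summable fun m : ℤ => |(m : ℝ)| ^ (-(3 / 2) : ℝ) :=
    Real.summable_abs_int_rpow (by norm_num)
  have h2 : Summable fun m : ℤ => if m = 0 then (1 : ℝ) else 0 := (hasSum_ite_eq 0 (1 : ℝ)).summable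
  refine (h1.add h2).of_nonneg_of_le (fun m => by positivity) fun m => ?_
  rcases eq_or_ne m 0 with rfl | hm
  · simp
  · have h0 : 0 < |(m : ℝ)| := abs_pos.2 (by exact_mod_cast hm)
    simp only [hm, if_false, add_zero]
    have : |(m : ℝ)| ^ (-(3 / 2) : ℝ) = (|(m : ℝ)| ^ 2) ^ (-(3 / 4) : ℝ) := by
      rw [← Real.rpow_natCast, ← Real.rpow_mul h0.le]; norm_num
    rw [this, sq_abs]
    refine Real.rpow_le_rpow_of_nonpos (by positivity) (by linarith) (by norm_num)

lemma summable_decay : Summable decay := by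
  have h := summable_one_add_sq_rpow.mul_of_nonneg summable_one_add_sq_rpow
    (fun m => by positivity) (fun m => by positivity)
  refine h.of_nonneg_of_le (fun ξ => (decay_pos ξ).le) fun ξ => ?_
  -- `(1 + ξ₁²)(1 + ξ₂²) ≤ (1 + |ξ|²)²`
  have h1 : decay ξ = (wt ξ ^ 2) ^ (-(3 / 4) : ℝ) := by
    rw [decay, ← Real.rpow_natCast, ← Real.rpow_mul (wt_pos ξ).le]; norm_num
  rw [h1, ← Real.mul_rpow (by positivity) (by positivity)]
  refine Real.rpow_le_rpow_of_nonpos (by positivity) ?_ (by norm_num)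
  unfold wt freqSq
  nlinarith [sq_nonneg (ξ.1 : ℝ), sq_nonneg (ξ.2 : ℝ), mul_nonneg (sq_nonneg (ξ.1 : ℝ))
    (sq_nonneg (ξ.2 : ℝ)), sq_nonneg ((ξ.1 : ℝ) ^ 2), sq_nonneg ((ξ.2 : ℝ) ^ 2)]

lemma summable_inv_wt_pow {k : ℕ} (hk : 2 ≤ k) : Summable fun ξ => (wt ξ ^ k)⁻¹ := by
  refine summable_decay.of_nonneg_of_le (fun ξ => by have := wt_pos ξ; positivity) fun ξ => ?_
  rw [← Real.rpow_natCast, ← Real.rpow_neg (wt_pos ξ).le]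
  refine Real.rpow_le_rpow_of_exponent_le (one_le_wt ξ) ?_
  have : (2 : ℝ) ≤ k := by exact_mod_cast hk
  linarith

/-! ### The linear symbol -/

/-- The fourth-order dissipation dominates the remaining terms of the symbol, up to a constant. -/
lemma exists_symbol_lower (ε δ β : ℝ) (hε : 0 < ε) :
    ∃ C : ℝ, 0 < C ∧ ∀ ξ, ε / 2 * wt ξ ^ 2 - C ≤ linearSymbol ε δ β ξ := by
  -- with `r = |ξ|` one has `δ r³ ≤ ε r⁴ / 4 + δ² r² / ε` and `K r² ≤ ε r⁴ / 4 + K² / ε`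
  set K := |β| + δ ^ 2 / ε + ε + 2
  have hK : 0 < K := by positivity
  refine ⟨K ^ 2 / ε + ε, by positivity, fun ξ => ?_⟩
  set r := Real.sqrt (freqSq ξ)
  have hr2 : r ^ 2 = freqSq ξ := Real.sq_sqrt (by unfold freqSq; positivity)
  have hx : (ξ.1 : ℝ) ^ 2 + (ξ.2 : ℝ) ^ 2 = r ^ 2 := hr2.symm
  have h1 : δ * r ^ 3 ≤ ε / 4 * r ^ 4 + δ ^ 2 / ε * r ^ 2 := by
    have : 0 ≤ r ^ 2 * (ε * r / 2 - δ) ^ 2 / ε := by positivity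
    have e : r ^ 2 * (ε * r / 2 - δ) ^ 2 / ε = ε / 4 * r ^ 4 + δ ^ 2 / ε * r ^ 2 - δ * r ^ 3 := by
      field_simp; ring
    linarith
  have h2 : K * r ^ 2 ≤ ε / 4 * r ^ 4 + K ^ 2 / ε := by
    have : 0 ≤ (ε * r ^ 2 / 2 - K) ^ 2 / ε := by positivity
    have e : (ε * r ^ 2 / 2 - K) ^ 2 / ε = ε / 4 * r ^ 4 + K ^ 2 / ε - K * r ^ 2 := by
      field_simp; ring
    linarith
  have h3 : β * (ξ.1 : ℝ) ^ 2 ≤ |β| * r ^ 2 := by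
    have := mul_le_mul_of_nonneg_right (le_abs_self β) (sq_nonneg (ξ.1 : ℝ))
    rw [← hx]
    nlinarith [mul_nonneg (abs_nonneg β) (sq_nonneg (ξ.2 : ℝ))]
  have e2 : K * r ^ 2 = |β| * r ^ 2 + δ ^ 2 / ε * r ^ 2 + ε * r ^ 2 + 2 * r ^ 2 := by
    simp only [K]; ring
  have hl : linearSymbol ε δ β ξ = r ^ 2 - β * (ξ.1 : ℝ) ^ 2 - δ * r ^ 3 + ε * r ^ 4 := by
    rw [linearSymbol, show Real.sqrt (freqSq ξ) = r from rfl, ← hr2]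
    linear_combination hx
  have hw : wt ξ = 1 + r ^ 2 := by rw [wt, hr2]
  rw [hl, hw]
  nlinarith [sq_nonneg r]

lemma exists_symbol_upper (ε δ β : ℝ) :
    ∃ C : ℝ, 0 < C ∧ ∀ ξ, |linearSymbol ε δ β ξ| ≤ C * wt ξ ^ 2 := by
  refine ⟨|β - 1| + 1 + |δ| + |ε| , by positivity, fun ξ => ?_⟩
  set r := Real.sqrt (freqSq ξ)
  have hr2 : r ^ 2 = freqSq ξ := Real.sq_sqrt (by unfold freqSq; positivity)
  have hr0 : 0 ≤ r := Real.sqrt_nonneg _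
  have hw : wt ξ = 1 + r ^ 2 := by rw [wt, hr2]
  have hx : (ξ.1 : ℝ) ^ 2 + (ξ.2 : ℝ) ^ 2 = r ^ 2 := hr2.symm
  have hw1 := one_le_wt ξ
  have hww : wt ξ ≤ wt ξ ^ 2 := by nlinarith
  have t1 : |(β - 1) * (-(ξ.1 : ℝ) ^ 2)| ≤ |β - 1| * wt ξ ^ 2 := by
    rw [abs_mul, abs_neg, abs_of_nonneg (sq_nonneg (ξ.1 : ℝ))]
    exact mul_le_mul_of_nonneg_left ((sq_fst_le_wt ξ).trans hww) (abs_nonneg _)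
  have t2 : |-(ξ.2 : ℝ) ^ 2| ≤ 1 * wt ξ ^ 2 := by
    rw [abs_neg, abs_of_nonneg (sq_nonneg (ξ.2 : ℝ))]
    nlinarith [sq_nonneg (ξ.1 : ℝ)]
  have t3 : |δ * r ^ 3| ≤ |δ| * wt ξ ^ 2 := by
    rw [abs_mul, abs_of_nonneg (pow_nonneg hr0 3)]
    refine mul_le_mul_of_nonneg_left ?_ (abs_nonneg _)
    rw [hw]; nlinarith [sq_nonneg (r * (r - 1)), sq_nonneg r, sq_nonneg (r * r)]
  have t4 : |ε * freqSq ξ ^ 2| ≤ |ε| * wt ξ ^ 2 := by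
    rw [abs_mul, abs_of_nonneg (sq_nonneg (freqSq ξ))]
    refine mul_le_mul_of_nonneg_left ?_ (abs_nonneg _)
    rw [hw, hr2.symm]; nlinarith [sq_nonneg r]
  simp only [linearSymbol]
  calc _ ≤ |(β - 1) * (-(ξ.1 : ℝ) ^ 2)| + |-(ξ.2 : ℝ) ^ 2| + |δ * r ^ 3| + |ε * freqSq ξ ^ 2| :=
        (abs_add_le _ _).trans (add_le_add_left ((abs_sub _ _).trans
          (add_le_add_left (abs_sub _ _) _)) _)
    _ ≤ _ := by linarith

lemma linearSymbol_reflect (ε δ β : ℝ) (ξ : ℤ × ℤ) :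
    linearSymbol ε δ β (reflect ξ) = linearSymbol ε δ β ξ := by simp [linearSymbol, freqSq]

/-! ### A differential inequality -/

lemma gronwall_linear {f f' : ℝ → ℝ} {s T c K : ℝ} (hc : c ≠ 0)
    (hd : ∀ t ∈ Set.Icc s T, HasDerivAt f (f' t) t)
    (h : ∀ t ∈ Set.Icc s T, f' t ≤ -c * f t + K) {t : ℝ} (ht : t ∈ Set.Icc s T) :
    f t - K / c ≤ Real.exp (-c * (t - s)) * (f s - K / c) := by
  have hd' : ∀ t ∈ Set.Icc s T, HasDerivAt (fun t => Real.exp (c * (t - s)) * (f t - K / c))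
      (Real.exp (c * (t - s)) * (c * f t - K + f' t)) t := fun t ht => by
    have h1 : HasDerivAt (fun t => Real.exp (c * (t - s))) (Real.exp (c * (t - s)) * c) t := by
      simpa using (((hasDerivAt_id t).sub_const s).const_mul c).exp
    convert! h1.mul ((hd t ht).sub_const (K / c)) using 1
    field_simp
  have hanti : AntitoneOn (fun t => Real.exp (c * (t - s)) * (f t - K / c)) (Set.Icc s T) := by
    refine antitoneOn_of_deriv_nonpos (convex_Icc s T)
      (fun t ht => (hd' t ht).continuousAt.continuousWithinAt)
      (fun t ht => (hd' t (interior_subset ht)).differentiableAt.differentiableWithinAt)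
      fun t ht => ?_
    rw [(hd' t (interior_subset ht)).deriv]
    have := h t (interior_subset ht)
    exact mul_nonpos_of_nonneg_of_nonpos (Real.exp_pos _).le (by linarith)
  have key := hanti ⟨le_rfl, ht.1.trans ht.2⟩ ht ht.1
  simp only [sub_self, mul_zero, Real.exp_zero, one_mul] at key
  have he : Real.exp (-c * (t - s)) * Real.exp (c * (t - s)) = 1 := by
    rw [← Real.exp_add]; simp
  calc f t - K / c = Real.exp (-c * (t - s)) * (Real.exp (c * (t - s)) * (f t - K / c)) := by
        rw [← mul_assoc, he, one_mul]
    _ ≤ _ := mul_le_mul_of_nonneg_left key (Real.exp_pos _).le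

/-! ### Convolutions -/

/-- The Fourier coefficients of `u² / 2`, for `u` with Fourier coefficients `a`. -/
def halfSq (a : ℤ × ℤ → ℂ) (ξ : ℤ × ℤ) : ℂ := 1 / 2 * ∑' μ, a μ * a (ξ - μ)

lemma summable_shift {f : ℤ × ℤ → ℝ} (hf : Summable f) (ξ : ℤ × ℤ) :
    Summable fun μ => f (ξ - μ) := (Equiv.subLeft ξ).summable_iff.2 hf

lemma tsum_shift (f : ℤ × ℤ → ℝ) (ξ : ℤ × ℤ) : ∑' μ, f (ξ - μ) = ∑' μ, f μ :=
  (Equiv.subLeft ξ).tsum_eq f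

lemma summable_conv {a b : ℤ × ℤ → ℂ} (ha : Summable fun ξ => ‖a ξ‖ ^ 2)
    (hb : Summable fun ξ => ‖b ξ‖ ^ 2) (ξ : ℤ × ℤ) : Summable fun μ => ‖a μ * b (ξ - μ)‖ := by
  refine (ha.add (summable_shift hb ξ)).of_nonneg_of_le (fun μ => norm_nonneg _) fun μ => ?_
  rw [norm_mul]
  nlinarith [sq_nonneg (‖a μ‖ - ‖b (ξ - μ)‖), sq_nonneg (‖a μ‖), sq_nonneg (‖b (ξ - μ)‖)]

lemma norm_halfSq_le {a : ℤ × ℤ → ℂ} (ha : Summable fun ξ => ‖a ξ‖ ^ 2) (ξ : ℤ × ℤ) :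
    ‖halfSq a ξ‖ ≤ ∑' μ, ‖a μ‖ ^ 2 := by
  have h1 : ‖∑' μ, a μ * a (ξ - μ)‖ ≤ ∑' μ, (‖a μ‖ ^ 2 + ‖a (ξ - μ)‖ ^ 2) := by
    refine (norm_tsum_le_tsum_norm (summable_conv ha ha ξ)).trans
      ((summable_conv ha ha ξ).tsum_le_tsum (fun μ => ?_) (ha.add (summable_shift ha ξ)))
    rw [norm_mul]
    nlinarith [sq_nonneg (‖a μ‖ - ‖a (ξ - μ)‖), sq_nonneg (‖a μ‖), sq_nonneg (‖a (ξ - μ)‖)]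
  rw [(ha).tsum_add (summable_shift ha ξ), tsum_shift (fun μ => ‖a μ‖ ^ 2)] at h1
  rw [halfSq, norm_mul]
  norm_num
  linarith

/-- Polynomial decay of order `3` is inherited, up to one order, by the convolution square. -/
lemma norm_halfSq_decay {a : ℤ × ℤ → ℂ} {C : ℝ}
    (ha : ∀ ξ, ‖a ξ‖ ≤ C * decay ξ) (ξ : ℤ × ℤ) :
    ‖halfSq a ξ‖ ≤ 2 * C ^ 2 * (∑' μ, decay μ) * (wt ξ)⁻¹ := by
  have hs := summable_shift summable_decay ξ
  have hC : 0 ≤ C := nonneg_of_mul_nonneg_left ((norm_nonneg _).trans (ha 0)) (decay_pos 0)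
  have hb : ∀ μ, ‖a μ * a (ξ - μ)‖ ≤ 2 * C ^ 2 * (wt ξ)⁻¹ * (decay (ξ - μ) + decay μ) := fun μ => by
    rw [norm_mul]
    have h1 := mul_le_mul (ha μ) (ha (ξ - μ)) (norm_nonneg _) ((norm_nonneg _).trans (ha μ))
    refine h1.trans ?_
    have h2 : wt ξ * (decay μ * decay (ξ - μ)) ≤ 2 * (decay (ξ - μ) + decay μ) := by
      have h3 := wt_add_le μ (ξ - μ)
      rw [add_sub_cancel] at h3
      have p1 := decay_pos μ
      have p2 := decay_pos (ξ - μ)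
      calc _ ≤ 2 * (wt μ + wt (ξ - μ)) * (decay μ * decay (ξ - μ)) :=
            mul_le_mul_of_nonneg_right h3 (by positivity)
        _ = 2 * (wt μ * decay μ * decay (ξ - μ) + wt (ξ - μ) * decay (ξ - μ) * decay μ) := by ring
        _ ≤ _ := by
            have q1 := mul_le_mul_of_nonneg_right (wt_mul_decay_le_one μ) p2.le
            have q2 := mul_le_mul_of_nonneg_right (wt_mul_decay_le_one (ξ - μ)) p1.le
            linarith
    have hw := wt_pos ξ
    have h4 : decay μ * decay (ξ - μ) ≤ (wt ξ)⁻¹ * (2 * (decay (ξ - μ) + decay μ)) := by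
      rw [le_inv_mul_iff₀ hw]; exact h2
    calc _ = C ^ 2 * (decay μ * decay (ξ - μ)) := by ring
      _ ≤ C ^ 2 * ((wt ξ)⁻¹ * (2 * (decay (ξ - μ) + decay μ))) :=
          mul_le_mul_of_nonneg_left h4 (by positivity)
      _ = _ := by ring
  have hsum := (hs.add summable_decay).mul_left (2 * C ^ 2 * (wt ξ)⁻¹)
  have h1 := tsum_of_norm_bounded hsum.hasSum hb
  rw [tsum_mul_left, hs.tsum_add summable_decay, tsum_shift decay] at h1
  rw [halfSq, norm_mul]
  norm_num
  linarith

/-! ### The system of ordinary differential equations for the Fourier modes -/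

/-- The time derivative of the mode `ξ` prescribed by the equation. -/
def rate (ε δ β : ℝ) (a : ℤ × ℤ → ℂ) (ξ : ℤ × ℤ) : ℂ :=
  -(Complex.I * (ξ.1 : ℂ) * halfSq a ξ + (linearSymbol ε δ β ξ : ℂ) * a ξ)

/-- The equation written for the Fourier coefficients `a t ξ` of a real-valued solution that is
continuous in time with values in `H²`. -/
structure ModeSystem (ε δ β : ℝ) (a : ℝ → ℤ × ℤ → ℂ) : Prop where
  conj_neg : ∀ t, 0 ≤ t → ∀ ξ, a t (-ξ) = starRingEnd ℂ (a t ξ)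
  summable : ∀ t, 0 ≤ t → Summable fun ξ => wt ξ ^ 2 * ‖a t ξ‖ ^ 2
  tendsto : ∀ t, 0 ≤ t →
    Tendsto (fun s => ∑' ξ, wt ξ ^ 2 * ‖a s ξ - a t ξ‖ ^ 2) (𝓝[Set.Ici 0] t) (𝓝 0)
  ode : ∀ ξ, ∀ t, 0 < t → HasDerivAt (fun s => a s ξ) (rate ε δ β (a t) ξ) t

lemma norm_sq_add_le (x y : ℂ) : ‖x + y‖ ^ 2 ≤ 2 * ‖x‖ ^ 2 + 2 * ‖y‖ ^ 2 := by
  have := norm_add_le x y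
  nlinarith [norm_nonneg (x + y), sq_nonneg (‖x‖ - ‖y‖), norm_nonneg x, norm_nonneg y]

lemma summable_norm_sq_of_wt {b : ℤ × ℤ → ℂ} (h : Summable fun ξ => wt ξ ^ 2 * ‖b ξ‖ ^ 2) :
    Summable fun ξ => ‖b ξ‖ ^ 2 :=
  h.of_nonneg_of_le (fun _ => by positivity) fun ξ =>
    le_mul_of_one_le_left (by positivity) (one_le_pow₀ (one_le_wt ξ))

lemma hasDerivAt_norm_sq {b : ℝ → ℂ} {b' : ℂ} {t : ℝ} (h : HasDerivAt b b' t) :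
    HasDerivAt (fun s => ‖b s‖ ^ 2) (2 * (starRingEnd ℂ (b t) * b').re) t := by
  have := h.norm_sq
  rwa [Complex.inner, mul_comm b'] at this

lemma re_conj_mul_rate (ε δ β : ℝ) (a : ℤ × ℤ → ℂ) (ξ : ℤ × ℤ) :
    (starRingEnd ℂ (a ξ) * rate ε δ β a ξ).re = -linearSymbol ε δ β ξ * ‖a ξ‖ ^ 2
      - (starRingEnd ℂ (a ξ) * (Complex.I * (ξ.1 : ℂ) * halfSq a ξ)).re := by
  have h : starRingEnd ℂ (a ξ) * a ξ = ((‖a ξ‖ ^ 2 : ℝ) : ℂ) := by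
    rw [mul_comm, Complex.mul_conj, Complex.normSq_eq_norm_sq]
  have e : starRingEnd ℂ (a ξ) * rate ε δ β a ξ =
      ((-linearSymbol ε δ β ξ * ‖a ξ‖ ^ 2 : ℝ) : ℂ)
        - starRingEnd ℂ (a ξ) * (Complex.I * (ξ.1 : ℂ) * halfSq a ξ) := by
    rw [rate]; push_cast at h ⊢; linear_combination (-(linearSymbol ε δ β ξ : ℂ)) * h
  rw [e, Complex.sub_re, Complex.ofReal_re]

/-- A termwise differentiable series of squared moduli. -/
lemma hasDerivAt_tsum_norm_sq {b b' : ℝ → ℤ × ℤ → ℂ} {s T C : ℝ}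
    (hd : ∀ ξ, ∀ t ∈ Set.Ioo s T, HasDerivAt (fun r => b r ξ) (b' t ξ) t)
    (hb : ∀ t ∈ Set.Ioo s T, ∀ ξ, ‖b t ξ‖ ≤ C * decay ξ)
    (hb' : ∀ t ∈ Set.Ioo s T, ∀ ξ, ‖b' t ξ‖ ≤ C) {t : ℝ} (ht : t ∈ Set.Ioo s T) :
    HasDerivAt (fun r => ∑' ξ, ‖b r ξ‖ ^ 2)
      (∑' ξ, 2 * (starRingEnd ℂ (b t ξ) * b' t ξ).re) t := by
  have hC : 0 ≤ C := (norm_nonneg _).trans (hb' t ht 0)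
  have hu : Summable fun ξ => 2 * C ^ 2 * decay ξ := summable_decay.mul_left _
  refine hasDerivAt_tsum_of_isPreconnected hu isOpen_Ioo isPreconnected_Ioo
    (fun ξ r hr => hasDerivAt_norm_sq (hd ξ r hr)) (fun ξ r hr => ?_) ht ?_ ht
  · rw [norm_mul, Real.norm_eq_abs, Real.norm_eq_abs]
    have h1 := Complex.abs_re_le_norm (starRingEnd ℂ (b r ξ) * b' r ξ)
    rw [norm_mul, RCLike.norm_conj] at h1
    have h2 := mul_le_mul (hb r hr ξ) (hb' r hr ξ) (norm_nonneg _)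
      (mul_nonneg hC (decay_pos ξ).le)
    rw [abs_two]
    linarith
  · refine (summable_decay.mul_left (C ^ 2)).of_nonneg_of_le (fun _ => by positivity) fun ξ => ?_
    have h2 := pow_le_pow_left₀ (norm_nonneg _) (hb t ht ξ) 2
    rw [mul_pow] at h2
    refine h2.trans (mul_le_mul_of_nonneg_left ?_ (by positivity))
    nlinarith [decay_pos ξ, decay_le_one ξ]

namespace ModeSystem

variable {ε δ β : ℝ} {a : ℝ → ℤ × ℤ → ℂ}

lemma summable_sq (h : ModeSystem ε δ β a) {t : ℝ} (ht : 0 ≤ t) :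
    Summable fun ξ => ‖a t ξ‖ ^ 2 := summable_norm_sq_of_wt (h.summable t ht)

lemma summable_sub (h : ModeSystem ε δ β a) {s t : ℝ} (hs : 0 ≤ s) (ht : 0 ≤ t) :
    Summable fun ξ => wt ξ ^ 2 * ‖a s ξ - a t ξ‖ ^ 2 := by
  refine (((h.summable s hs).mul_left 2).add ((h.summable t ht).mul_left 2)).of_nonneg_of_le
    (fun ξ => by positivity) fun ξ => ?_
  have := norm_sq_add_le (a s ξ) (-a t ξ)
  rw [norm_neg, ← sub_eq_add_neg] at this
  have := mul_le_mul_of_nonneg_left this (sq_nonneg (wt ξ))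
  linarith

/-- The square of the `H²` norm is bounded on bounded time intervals. -/
lemma exists_bound (h : ModeSystem ε δ β a) (T : ℝ) :
    ∃ L : ℝ, ∀ t ∈ Set.Icc 0 T, ∑' ξ, wt ξ ^ 2 * ‖a t ξ‖ ^ 2 ≤ L := by
  refine (isCompact_Icc (a := (0 : ℝ)) (b := T)).induction_on
    (p := fun S => ∃ L : ℝ, ∀ t ∈ S, ∑' ξ, wt ξ ^ 2 * ‖a t ξ‖ ^ 2 ≤ L) ⟨0, by simp⟩
    (fun S S' hSS ⟨L, hL⟩ => ⟨L, fun t ht => hL t (hSS ht)⟩)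
    (fun S S' ⟨L, hL⟩ ⟨L', hL'⟩ => ⟨max L L', ?_⟩) fun t ht => ?_
  · rintro t (ht | ht)
    · exact (hL t ht).trans (le_max_left _ _)
    · exact (hL' t ht).trans (le_max_right _ _)
  · have h1 := (h.tendsto t ht.1).eventually (gt_mem_nhds one_pos)
    rw [eventually_nhdsWithin_iff] at h1
    refine ⟨{s | s ∈ Set.Ici 0 → ∑' ξ, wt ξ ^ 2 * ‖a s ξ - a t ξ‖ ^ 2 < 1} ∩ Set.Icc 0 T,
      inter_mem (mem_nhdsWithin_of_mem_nhds h1) self_mem_nhdsWithin,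
      2 * 1 + 2 * ∑' ξ, wt ξ ^ 2 * ‖a t ξ‖ ^ 2, fun s hs => ?_⟩
    have hlt := hs.1 hs.2.1
    have hsum := h.summable_sub hs.2.1 ht.1
    calc _ ≤ ∑' ξ, (2 * (wt ξ ^ 2 * ‖a s ξ - a t ξ‖ ^ 2) + 2 * (wt ξ ^ 2 * ‖a t ξ‖ ^ 2)) := by
          refine (h.summable s hs.2.1).tsum_le_tsum (fun ξ => ?_)
            ((hsum.mul_left 2).add ((h.summable t ht.1).mul_left 2))
          have := norm_sq_add_le (a s ξ - a t ξ) (a t ξ)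
          rw [sub_add_cancel] at this
          have := mul_le_mul_of_nonneg_left this (sq_nonneg (wt ξ))
          linarith
      _ = 2 * (∑' ξ, wt ξ ^ 2 * ‖a s ξ - a t ξ‖ ^ 2) + 2 * ∑' ξ, wt ξ ^ 2 * ‖a t ξ‖ ^ 2 := by
          rw [(hsum.mul_left 2).tsum_add ((h.summable t ht.1).mul_left 2), tsum_mul_left,
            tsum_mul_left]
      _ ≤ _ := by linarith

/-- The `L²` norm at small positive times is controlled by the initial one. -/
lemma exists_time_energy_le (h : ModeSystem ε δ β a) :
    ∃ s, 0 < s ∧ s ≤ 1 ∧ ∑' ξ, ‖a s ξ‖ ^ 2 ≤ 2 + 2 * ∑' ξ, ‖a 0 ξ‖ ^ 2 := by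
  have h1 := (h.tendsto 0 le_rfl).eventually (gt_mem_nhds one_pos)
  have h2 : ∀ᶠ s in 𝓝[>] (0 : ℝ), ∑' ξ, wt ξ ^ 2 * ‖a s ξ - a 0 ξ‖ ^ 2 < 1 :=
    h1.filter_mono (nhdsWithin_mono _ Set.Ioi_subset_Ici_self)
  obtain ⟨s, hs, hs01⟩ := (h2.and (Ioc_mem_nhdsGT one_pos)).exists
  have hsum := h.summable_sub hs01.1.le le_rfl
  have hsum' := summable_norm_sq_of_wt hsum
  refine ⟨s, hs01.1, hs01.2, ?_⟩
  have h3 : ∑' ξ, ‖a s ξ - a 0 ξ‖ ^ 2 ≤ ∑' ξ, wt ξ ^ 2 * ‖a s ξ - a 0 ξ‖ ^ 2 :=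
    hsum'.tsum_le_tsum (fun ξ => le_mul_of_one_le_left (by positivity)
      (one_le_pow₀ (one_le_wt ξ))) hsum
  have h0 := h.summable_sq le_rfl
  calc _ ≤ ∑' ξ, (2 * ‖a s ξ - a 0 ξ‖ ^ 2 + 2 * ‖a 0 ξ‖ ^ 2) := by
        refine (h.summable_sq hs01.1.le).tsum_le_tsum (fun ξ => ?_)
          ((hsum'.mul_left 2).add (h0.mul_left 2))
        have := norm_sq_add_le (a s ξ - a 0 ξ) (a 0 ξ)
        rwa [sub_add_cancel] at this
    _ = 2 * (∑' ξ, ‖a s ξ - a 0 ξ‖ ^ 2) + 2 * ∑' ξ, ‖a 0 ξ‖ ^ 2 := by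
        rw [(hsum'.mul_left 2).tsum_add (h0.mul_left 2), tsum_mul_left, tsum_mul_left]
    _ ≤ _ := by linarith

/-! ### Parabolic smoothing, one mode at a time -/

/-- If a mode and its forcing are bounded on `[s, T]`, then from time `s + τ` on the mode is smaller
by powers of the weight. The constant does not depend on the mode or on the solution. -/
lemma exists_mode_decay (δ β : ℝ) (hε : 0 < ε) {τ : ℝ} (hτ : 0 < τ) :
    ∃ K : ℝ, 0 < K ∧ ∀ a, ModeSystem ε δ β a → ∀ (ξ : ℤ × ℤ) (s T Q B : ℝ), 0 < s →
      (∀ t ∈ Set.Icc s T, ‖a t ξ‖ ^ 2 ≤ Q) → (∀ t ∈ Set.Icc s T, ‖halfSq (a t) ξ‖ ^ 2 ≤ B) →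
      ∀ t ∈ Set.Icc (s + τ) T,
        ‖a t ξ‖ ^ 2 ≤ K * (Q * (wt ξ ^ 2)⁻¹ + B * (wt ξ ^ 3)⁻¹) := by
  obtain ⟨C, hC, hlow⟩ := exists_symbol_lower ε δ β hε
  refine ⟨2 / (ε * τ) + 4 * C / ε + 4 / ε ^ 2, by positivity,
    fun a h ξ s T Q B hs hQ hB t ht => ?_⟩
  have hts : t ∈ Set.Icc s T := ⟨by linarith [ht.1], ht.2⟩
  have hQ0 : 0 ≤ Q := (sq_nonneg _).trans (hQ t hts)
  have hB0 : 0 ≤ B := (sq_nonneg _).trans (hB t hts)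
  have hw := wt_pos ξ
  set c := ε / 2 * wt ξ ^ 2 with hc
  have hc0 : 0 < c := by positivity
  set K := 2 * C * Q + 2 / ε * B * (wt ξ)⁻¹ with hK
  have hK0 : 0 ≤ K := by positivity
  have key := gronwall_linear (f := fun t => ‖a t ξ‖ ^ 2) (c := c) (K := K) (s := s) (T := T)
    hc0.ne' (fun r hr => hasDerivAt_norm_sq (h.ode ξ r (hs.trans_le hr.1))) (fun r hr => ?_) hts
  · have h1 : Real.exp (-c * (t - s)) ≤ (c * τ)⁻¹ := by
      rw [neg_mul, Real.exp_neg]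
      refine inv_anti₀ (by positivity) ?_
      have h2 : c * τ ≤ c * (t - s) := mul_le_mul_of_nonneg_left (by linarith [ht.1]) hc0.le
      linarith [Real.add_one_le_exp (c * (t - s))]
    have h2 : ‖a s ξ‖ ^ 2 - K / c ≤ Q := by
      have := hQ s ⟨le_rfl, hts.1.trans hts.2⟩
      have : 0 ≤ K / c := by positivity
      linarith
    have h3 : Real.exp (-c * (t - s)) * (‖a s ξ‖ ^ 2 - K / c) ≤ (c * τ)⁻¹ * Q :=
      (mul_le_mul_of_nonneg_left h2 (Real.exp_pos _).le).trans (mul_le_mul_of_nonneg_right h1 hQ0)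
    have e : (c * τ)⁻¹ * Q + K / c = (2 / (ε * τ) + 4 * C / ε) * (Q * (wt ξ ^ 2)⁻¹)
        + 4 / ε ^ 2 * (B * (wt ξ ^ 3)⁻¹) := by
      rw [hK, hc]; field_simp; ring
    have p1 : 0 ≤ (2 / (ε * τ) + 4 * C / ε) * (B * (wt ξ ^ 3)⁻¹) := by positivity
    have p2 : 0 ≤ 4 / ε ^ 2 * (Q * (wt ξ ^ 2)⁻¹) := by positivity
    linarith
  · have h1 : |(starRingEnd ℂ (a r ξ) * (Complex.I * (ξ.1 : ℂ) * halfSq (a r) ξ)).re|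
        ≤ ‖a r ξ‖ * (|(ξ.1 : ℝ)| * ‖halfSq (a r) ξ‖) := by
      refine (Complex.abs_re_le_norm _).trans (le_of_eq ?_)
      simp
    have h2 := neg_abs_le ((starRingEnd ℂ (a r ξ) * (Complex.I * (ξ.1 : ℂ) * halfSq (a r) ξ)).re)
    -- the transport term is absorbed by half of the dissipation
    have h3 : 2 * (‖a r ξ‖ * (|(ξ.1 : ℝ)| * ‖halfSq (a r) ξ‖)) ≤
        ε / 2 * wt ξ ^ 2 * ‖a r ξ‖ ^ 2 + 2 / ε * (B * (wt ξ)⁻¹) := by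
      have h4 : 0 ≤ (ε / 2 * wt ξ * ‖a r ξ‖ - (wt ξ)⁻¹ * (|(ξ.1 : ℝ)| * ‖halfSq (a r) ξ‖)) ^ 2
          * (2 / ε) := by positivity
      have e : (ε / 2 * wt ξ * ‖a r ξ‖ - (wt ξ)⁻¹ * (|(ξ.1 : ℝ)| * ‖halfSq (a r) ξ‖)) ^ 2
          * (2 / ε) = ε / 2 * wt ξ ^ 2 * ‖a r ξ‖ ^ 2
            + 2 / ε * ((wt ξ)⁻¹ ^ 2 * ((ξ.1 : ℝ) ^ 2 * ‖halfSq (a r) ξ‖ ^ 2))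
            - 2 * (‖a r ξ‖ * (|(ξ.1 : ℝ)| * ‖halfSq (a r) ξ‖)) := by
        rw [← sq_abs (ξ.1 : ℝ)]; field_simp; ring
      have h5 : (wt ξ)⁻¹ ^ 2 * ((ξ.1 : ℝ) ^ 2 * ‖halfSq (a r) ξ‖ ^ 2) ≤ B * (wt ξ)⁻¹ := by
        have := mul_le_mul (sq_fst_le_wt ξ) (hB r hr) (sq_nonneg _) hw.le
        calc _ ≤ (wt ξ)⁻¹ ^ 2 * (wt ξ * B) := mul_le_mul_of_nonneg_left this (by positivity)
          _ = _ := by field_simp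
      have h6 := mul_le_mul_of_nonneg_left h5 (show 0 ≤ 2 / ε by positivity)
      linarith
    have h4 := mul_le_mul_of_nonneg_right (hlow ξ) (sq_nonneg ‖a r ξ‖)
    have h5 := mul_le_mul_of_nonneg_left (hQ r hr) hC.le
    rw [re_conj_mul_rate, hK, hc]
    linarith

lemma le_sqrt_mul_decay {x C : ℝ} {ξ : ℤ × ℤ} (hC : 0 ≤ C) (h : x ^ 2 ≤ C * (wt ξ ^ 3)⁻¹) :
    x ≤ Real.sqrt C * decay ξ := by
  refine abs_le_of_sq_le_sq' ?_ (by have := decay_pos ξ; positivity) |>.2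
  rwa [mul_pow, Real.sq_sqrt hC, decay_sq]

/-- Three smoothing steps: an `L²` bound on a time interval gives, after the waiting time `3 τ`,
decay of order `5` of the Fourier coefficients. -/
lemma exists_decay_of_energy_le (δ β : ℝ) (hε : 0 < ε) {τ R : ℝ} (hτ : 0 < τ) (hR : 0 ≤ R) :
    ∃ C : ℝ, 0 ≤ C ∧ ∀ a, ModeSystem ε δ β a → ∀ s T : ℝ, 0 < s →
      (∀ t ∈ Set.Icc s T, ∑' ξ, ‖a t ξ‖ ^ 2 ≤ R) →
      ∀ t ∈ Set.Icc (s + 3 * τ) T, ∀ ξ, ‖a t ξ‖ ^ 2 ≤ C * (wt ξ ^ 5)⁻¹ := by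
  obtain ⟨K, hK, hstep⟩ := exists_mode_decay (ε := ε) δ β hε hτ
  set C1 := K * (R + R ^ 2)
  set C2 := K * (C1 + R ^ 2)
  set D := 2 * Real.sqrt C2 ^ 2 * ∑' μ, decay μ
  have hC1 : 0 ≤ C1 := by positivity
  have hC2 : 0 ≤ C2 := by positivity
  refine ⟨K * (C2 + D ^ 2), by positivity, fun a h s T hs hE => ?_⟩
  have hN : ∀ ξ, ∀ t ∈ Set.Icc s T, ‖halfSq (a t) ξ‖ ^ 2 ≤ R ^ 2 := fun ξ t ht =>
    pow_le_pow_left₀ (norm_nonneg _)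
      ((norm_halfSq_le (h.summable_sq (hs.le.trans ht.1)) ξ).trans (hE t ht)) 2
  have s1 : ∀ ξ, ∀ t ∈ Set.Icc (s + τ) T, ‖a t ξ‖ ^ 2 ≤ C1 * (wt ξ ^ 2)⁻¹ := fun ξ t ht => by
    refine (hstep a h ξ s T R (R ^ 2) hs (fun r hr => ?_) (hN ξ) t ht).trans ?_
    · exact ((h.summable_sq (hs.le.trans hr.1)).le_tsum ξ (fun _ _ => by positivity)).trans
        (hE r hr)
    · have hw : (wt ξ ^ 3)⁻¹ ≤ (wt ξ ^ 2)⁻¹ := inv_anti₀ (pow_pos (wt_pos ξ) 2)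
        (pow_le_pow_right₀ (one_le_wt ξ) (by norm_num))
      have := mul_le_mul_of_nonneg_left hw (sq_nonneg R)
      calc _ ≤ K * (R * (wt ξ ^ 2)⁻¹ + R ^ 2 * (wt ξ ^ 2)⁻¹) :=
            mul_le_mul_of_nonneg_left (by linarith) hK.le
        _ = _ := by ring
  have s2 : ∀ ξ, ∀ t ∈ Set.Icc (s + τ + τ) T, ‖a t ξ‖ ^ 2 ≤ C2 * (wt ξ ^ 3)⁻¹ := fun ξ t ht => by
    refine (hstep a h ξ (s + τ) T (C1 * (wt ξ ^ 2)⁻¹) (R ^ 2) (by positivity) (s1 ξ)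
      (fun r hr => hN ξ r ⟨by linarith [hr.1], hr.2⟩) t ht).trans ?_
    have hw : (wt ξ ^ 2)⁻¹ * (wt ξ ^ 2)⁻¹ ≤ (wt ξ ^ 3)⁻¹ := by
      rw [← mul_inv, ← pow_add]
      exact inv_anti₀ (pow_pos (wt_pos ξ) 3) (pow_le_pow_right₀ (one_le_wt ξ) (by norm_num))
    have := mul_le_mul_of_nonneg_left hw hC1
    calc _ ≤ K * (C1 * (wt ξ ^ 3)⁻¹ + R ^ 2 * (wt ξ ^ 3)⁻¹) :=
          mul_le_mul_of_nonneg_left (by linarith) hK.le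
      _ = _ := by ring
  intro t ht ξ
  refine (hstep a h ξ (s + τ + τ) T (C2 * (wt ξ ^ 3)⁻¹) (D ^ 2 * (wt ξ ^ 2)⁻¹) (by positivity)
    (s2 ξ) (fun r hr => ?_) t ⟨by linarith [ht.1], ht.2⟩).trans (le_of_eq ?_)
  · have := norm_halfSq_decay (fun ξ => le_sqrt_mul_decay hC2 (s2 ξ r hr)) ξ
    refine (pow_le_pow_left₀ (norm_nonneg _) this 2).trans (le_of_eq ?_)
    simp only [D]
    rw [mul_pow _ ((wt ξ)⁻¹), inv_pow]
  · have := wt_pos ξ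
    field_simp

/-- On compact subintervals of `(0, ∞)` the modes and their time derivatives are bounded uniformly,
with decay that makes every series below converge absolutely. -/
lemma exists_uniform_decay (h : ModeSystem ε δ β a) (hε : 0 < ε) {s : ℝ} (hs : 0 < s) (T : ℝ) :
    ∃ C : ℝ, ∀ t ∈ Set.Icc s T, ∀ ξ,
      wt ξ * ‖a t ξ‖ ≤ C * decay ξ ∧ ‖rate ε δ β (a t) ξ‖ ≤ C := by
  obtain ⟨L, hL⟩ := h.exists_bound T
  have hL' : ∀ t ∈ Set.Icc (s / 4) T, ∑' ξ, ‖a t ξ‖ ^ 2 ≤ max L 0 := fun t ht => by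
    have ht0 : 0 ≤ t := le_trans (by positivity) ht.1
    refine le_trans ?_ ((hL t ⟨ht0, ht.2⟩).trans (le_max_left _ _))
    exact (h.summable_sq ht0).tsum_le_tsum (fun ξ => le_mul_of_one_le_left (by positivity)
      (one_le_pow₀ (one_le_wt ξ))) (h.summable t ht0)
  obtain ⟨C, hC, hdec⟩ := exists_decay_of_energy_le (ε := ε) δ β hε (τ := s / 4)
    (R := max L 0) (by positivity) (le_max_right _ _)
  obtain ⟨S, hS, hsym⟩ := exists_symbol_upper ε δ β
  have hw : ∀ t ∈ Set.Icc s T, ∀ ξ, wt ξ * ‖a t ξ‖ ≤ Real.sqrt C * decay ξ := fun t ht ξ => by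
    refine le_sqrt_mul_decay hC ?_
    have h1 := hdec a h (s / 4) T (by positivity) hL' t ⟨by linarith [ht.1], ht.2⟩ ξ
    have hw0 := wt_pos ξ
    calc _ = wt ξ ^ 2 * ‖a t ξ‖ ^ 2 := by ring
      _ ≤ wt ξ ^ 2 * (C * (wt ξ ^ 5)⁻¹) := mul_le_mul_of_nonneg_left h1 (by positivity)
      _ = _ := by field_simp
  set D := 2 * Real.sqrt C ^ 2 * ∑' μ, decay μ
  have hD : 0 ≤ D := mul_nonneg (by positivity) (tsum_nonneg fun ξ => (decay_pos ξ).le)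
  refine ⟨Real.sqrt C + (D + S * Real.sqrt C), fun t ht ξ => ⟨(hw t ht ξ).trans ?_, ?_⟩⟩
  · refine mul_le_mul_of_nonneg_right ?_ (decay_pos ξ).le
    have : 0 ≤ S * Real.sqrt C := by positivity
    linarith
  · have hw1 := one_le_wt ξ
    have hN := norm_halfSq_decay (a := a t) (C := Real.sqrt C) (fun ξ =>
      (le_mul_of_one_le_left (norm_nonneg _) (one_le_wt ξ)).trans (hw t ht ξ)) ξ
    have h1 : |(ξ.1 : ℝ)| ≤ wt ξ := by
      have := sq_fst_le_wt ξ
      rw [← sq_abs] at this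
      nlinarith [abs_nonneg (ξ.1 : ℝ)]
    have h2 : |(ξ.1 : ℝ)| * ‖halfSq (a t) ξ‖ ≤ D := by
      have hw0 := wt_pos ξ
      calc _ ≤ wt ξ * (D * (wt ξ)⁻¹) := mul_le_mul h1 hN (norm_nonneg _) hw0.le
        _ = D := by field_simp
    have h3 : |linearSymbol ε δ β ξ| * ‖a t ξ‖ ≤ S * Real.sqrt C := by
      calc _ ≤ S * wt ξ ^ 2 * ‖a t ξ‖ := mul_le_mul_of_nonneg_right (hsym ξ) (norm_nonneg _)
        _ = S * (wt ξ * (wt ξ * ‖a t ξ‖)) := by ring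
        _ ≤ S * (wt ξ * (Real.sqrt C * decay ξ)) :=
            mul_le_mul_of_nonneg_left (mul_le_mul_of_nonneg_left (hw t ht ξ) (by linarith)) hS.le
        _ = S * Real.sqrt C * (wt ξ * decay ξ) := by ring
        _ ≤ S * Real.sqrt C * 1 :=
            mul_le_mul_of_nonneg_left (wt_mul_decay_le_one ξ) (by positivity)
        _ = _ := mul_one _
    rw [rate, norm_neg]
    refine (norm_add_le _ _).trans ?_
    have e : ‖Complex.I * (ξ.1 : ℂ) * halfSq (a t) ξ‖ = |(ξ.1 : ℝ)| * ‖halfSq (a t) ξ‖ := by simp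
    rw [e, norm_mul, Complex.norm_real, Real.norm_eq_abs]
    linarith [Real.sqrt_nonneg C]

end ModeSystem

/-! ### Uniqueness, and propagation of oddness -/

/-- The change of variables `(ξ, μ) ↦ (μ, ξ - μ)` in convolution sums. -/
def convEquiv : (ℤ × ℤ) × (ℤ × ℤ) ≃ (ℤ × ℤ) × (ℤ × ℤ) where
  toFun p := (p.2, p.1 - p.2)
  invFun p := (p.1 + p.2, p.1)
  left_inv p := by simp
  right_inv p := by simp

lemma summable_prod_conv {f g : ℤ × ℤ → ℝ} (hf : Summable f) (hg : Summable g)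
    (hf0 : 0 ≤ f) (hg0 : 0 ≤ g) :
    Summable fun p : (ℤ × ℤ) × (ℤ × ℤ) => f p.2 * g (p.1 - p.2) :=
  convEquiv.summable_iff.2 (hf.mul_of_nonneg hg hf0 hg0)

lemma hasSum_tsum_conv {f g : ℤ × ℤ → ℝ} (hf : Summable f) (hg : Summable g)
    (hf0 : 0 ≤ f) (hg0 : 0 ≤ g) :
    HasSum (fun ξ => ∑' μ, f μ * g (ξ - μ)) ((∑' ξ, f ξ) * ∑' ξ, g ξ) := by
  have h1 := hf.mul_of_nonneg hg hf0 hg0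
  have h2 := summable_prod_conv hf hg hf0 hg0
  rw [hf.tsum_mul_tsum hg h1, ← convEquiv.tsum_eq]
  exact h2.hasSum.prod_fiberwise fun ξ => (h2.prod_factor ξ).hasSum

namespace ModeSystem

variable {ε δ β : ℝ} {a : ℝ → ℤ × ℤ → ℂ}

/-- For a function `u` and its reflection `v`, the factorisation `u² - v² = (u + v) (u - v)`, in terms
of Fourier coefficients. -/
lemma halfSq_sub_reflect {b : ℤ × ℤ → ℂ} (hb : Summable fun ξ => ‖b ξ‖ ^ 2) (ξ : ℤ × ℤ) :
    halfSq b ξ - halfSq b (reflect ξ) =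
      1 / 2 * ∑' μ, (b μ + b (reflect μ)) * (b (ξ - μ) - b (reflect (ξ - μ))) := by
  have hb' : Summable fun ξ => ‖b (reflect ξ)‖ ^ 2 := reflect.toEquiv.summable_iff.2 hb
  have s1 := (summable_conv hb hb ξ).of_norm
  have s2 := (summable_conv hb hb' ξ).of_norm
  have s3 := (summable_conv hb' hb ξ).of_norm
  have s4 := (summable_conv hb' hb' ξ).of_norm
  have e1 : ∑' μ, b (reflect μ) * b (ξ - μ) = ∑' μ, b μ * b (reflect (ξ - μ)) := by
    rw [← (Equiv.subLeft ξ).tsum_eq]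
    exact tsum_congr fun μ => by simp [mul_comm]
  have e2 : ∑' μ, b μ * b (reflect ξ - μ) = ∑' μ, b (reflect μ) * b (reflect (ξ - μ)) := by
    rw [← reflect.toEquiv.tsum_eq]
    exact tsum_congr fun μ => by simp
  have e3 : ∑' μ, (b μ + b (reflect μ)) * (b (ξ - μ) - b (reflect (ξ - μ))) =
      (∑' μ, b μ * b (ξ - μ) - ∑' μ, b μ * b (reflect (ξ - μ)))
      + (∑' μ, b (reflect μ) * b (ξ - μ) - ∑' μ, b (reflect μ) * b (reflect (ξ - μ))) := by
    rw [← s1.tsum_sub s2, ← s3.tsum_sub s4, ← (s1.sub s2).tsum_add (s3.sub s4)]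
    exact tsum_congr fun μ => by ring
  rw [e3, e1, halfSq, halfSq, e2]
  ring

lemma summable_of_wt {b : ℤ × ℤ → ℂ} (h : Summable fun ξ => wt ξ ^ 2 * ‖b ξ‖ ^ 2) :
    (Summable fun ξ => ‖b ξ‖) ∧
      ∑' ξ, ‖b ξ‖ ≤ (∑' ξ, (wt ξ ^ 2)⁻¹) + ∑' ξ, wt ξ ^ 2 * ‖b ξ‖ ^ 2 := by
  have hs := (summable_inv_wt_pow le_rfl).add h
  have hle : ∀ ξ, ‖b ξ‖ ≤ (wt ξ ^ 2)⁻¹ + wt ξ ^ 2 * ‖b ξ‖ ^ 2 := fun ξ => by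
    have hw := wt_pos ξ
    have h1 : 0 ≤ ((wt ξ)⁻¹ - wt ξ * ‖b ξ‖) ^ 2 := sq_nonneg _
    have e : ((wt ξ)⁻¹ - wt ξ * ‖b ξ‖) ^ 2 =
        (wt ξ ^ 2)⁻¹ + wt ξ ^ 2 * ‖b ξ‖ ^ 2 - 2 * ‖b ξ‖ := by field_simp; ring
    linarith [norm_nonneg (b ξ)]
  have h1 := hs.of_nonneg_of_le (fun ξ => norm_nonneg _) hle
  exact ⟨h1, (h1.tsum_le_tsum hle hs).trans_eq ((summable_inv_wt_pow le_rfl).tsum_add h)⟩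

/-- The energy inequality for the even part `d` of a solution whose odd part is `c` (up to factors
`1 / 2`): the equation for `d` is linear in `d`, with coefficient `c`. -/
lemma energy_even_part_le {C S Λ : ℝ} {c d : ℤ × ℤ → ℂ} (hε : 0 < ε)
    (hlow : ∀ ξ, ε / 2 * wt ξ ^ 2 - S ≤ linearSymbol ε δ β ξ)
    (hd : ∀ ξ, wt ξ * ‖d ξ‖ ≤ C * decay ξ) (hc : Summable fun ξ => ‖c ξ‖)
    (hcΛ : ∑' ξ, ‖c ξ‖ ≤ Λ)
    (hr : Summable fun ξ => (2 * (starRingEnd ℂ (d ξ) * -(Complex.I * (ξ.1 : ℂ) *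
      (1 / 2 * ∑' μ, d μ * c (ξ - μ)) + (linearSymbol ε δ β ξ : ℂ) * d ξ)).re)) :
    ∑' ξ, (2 * (starRingEnd ℂ (d ξ) * -(Complex.I * (ξ.1 : ℂ) *
      (1 / 2 * ∑' μ, d μ * c (ξ - μ)) + (linearSymbol ε δ β ξ : ℂ) * d ξ)).re)
      ≤ (2 * S + Λ ^ 2 / ε + 1) * ∑' ξ, ‖d ξ‖ ^ 2 := by
  have hC : 0 ≤ C := nonneg_of_mul_nonneg_left
    ((mul_nonneg (wt_pos 0).le (norm_nonneg _)).trans (hd 0)) (decay_pos 0)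
  have hΛ : 0 ≤ Λ := (tsum_nonneg fun ξ => norm_nonneg _).trans hcΛ
  have hd2 : Summable fun ξ => wt ξ ^ 2 * ‖d ξ‖ ^ 2 := by
    refine (summable_decay.mul_left (C ^ 2)).of_nonneg_of_le (fun _ => by positivity) fun ξ => ?_
    have hw := wt_pos ξ
    have h2 := pow_le_pow_left₀ (by positivity) (hd ξ) 2
    rw [mul_pow, mul_pow] at h2
    refine h2.trans (mul_le_mul_of_nonneg_left ?_ (by positivity))
    nlinarith [decay_pos ξ, decay_le_one ξ]
  have hD := summable_norm_sq_of_wt hd2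
  have hconv := hasSum_tsum_conv hD hc (fun _ => by positivity) (fun _ => norm_nonneg _)
  have hrow := (summable_prod_conv hD hc (fun _ => by positivity) (fun _ => norm_nonneg _))
  have hdb : ∀ μ, ‖d μ‖ ≤ C := fun μ => by
    refine (le_mul_of_one_le_left (norm_nonneg _) (one_le_wt μ)).trans ((hd μ).trans ?_)
    exact mul_le_of_le_one_right hC (decay_le_one μ)
  have hdc : ∀ ξ, Summable fun μ => ‖d μ * c (ξ - μ)‖ := fun ξ => by
    refine ((summable_shift hc ξ).mul_left C).of_nonneg_of_le (fun _ => norm_nonneg _)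
      fun μ => ?_
    rw [norm_mul]
    exact mul_le_mul_of_nonneg_right (hdb μ) (norm_nonneg _)
  have hpt : ∀ ξ, (2 * (starRingEnd ℂ (d ξ) * -(Complex.I * (ξ.1 : ℂ) *
      (1 / 2 * ∑' μ, d μ * c (ξ - μ)) + (linearSymbol ε δ β ξ : ℂ) * d ξ)).re)
      ≤ (2 * S + Λ ^ 2 / ε) * ‖d ξ‖ ^ 2 - Λ / 2 * ‖d ξ‖ ^ 2
        + 1 / 2 * ∑' μ, ‖d μ‖ ^ 2 * ‖c (ξ - μ)‖ := fun ξ => by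
    have hw := wt_pos ξ
    set N := 1 / 2 * ∑' μ, d μ * c (ξ - μ) with hNdef
    have hre : (starRingEnd ℂ (d ξ) * -(Complex.I * (ξ.1 : ℂ) * N
        + (linearSymbol ε δ β ξ : ℂ) * d ξ)).re = -linearSymbol ε δ β ξ * ‖d ξ‖ ^ 2
        - (starRingEnd ℂ (d ξ) * (Complex.I * (ξ.1 : ℂ) * N)).re := by
      have h : starRingEnd ℂ (d ξ) * d ξ = ((‖d ξ‖ ^ 2 : ℝ) : ℂ) := by
        rw [mul_comm, Complex.mul_conj, Complex.normSq_eq_norm_sq]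
      have e : starRingEnd ℂ (d ξ) * -(Complex.I * (ξ.1 : ℂ) * N
          + (linearSymbol ε δ β ξ : ℂ) * d ξ) =
          ((-linearSymbol ε δ β ξ * ‖d ξ‖ ^ 2 : ℝ) : ℂ)
            - starRingEnd ℂ (d ξ) * (Complex.I * (ξ.1 : ℂ) * N) := by
        push_cast at h ⊢; linear_combination (-(linearSymbol ε δ β ξ : ℂ)) * h
      rw [e, Complex.sub_re, Complex.ofReal_re]
    have h1 : |(starRingEnd ℂ (d ξ) * (Complex.I * (ξ.1 : ℂ) * N)).re|
        ≤ |(ξ.1 : ℝ)| * ‖d ξ‖ * ‖N‖ := by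
      refine (Complex.abs_re_le_norm _).trans (le_of_eq ?_)
      simp; ring
    have h2 : 2 * (|(ξ.1 : ℝ)| * ‖d ξ‖ * ‖N‖) ≤
        Λ / 2 * (wt ξ * ‖d ξ‖ ^ 2) + 1 / 2 * ∑' μ, ‖d μ‖ ^ 2 * ‖c (ξ - μ)‖ := by
      have hN : 2 * ‖N‖ ≤ ∑' μ, ‖d μ * c (ξ - μ)‖ := by
        rw [hNdef, norm_mul]
        have := norm_tsum_le_tsum_norm (hdc ξ)
        norm_num at this ⊢
        linarith
      have hy := (summable_shift hc ξ).mul_left (wt ξ * ‖d ξ‖ ^ 2)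
      calc 2 * (|(ξ.1 : ℝ)| * ‖d ξ‖ * ‖N‖) = |(ξ.1 : ℝ)| * ‖d ξ‖ * (2 * ‖N‖) := by ring
        _ ≤ |(ξ.1 : ℝ)| * ‖d ξ‖ * ∑' μ, ‖d μ * c (ξ - μ)‖ :=
            mul_le_mul_of_nonneg_left hN (by positivity)
        _ = ∑' μ, |(ξ.1 : ℝ)| * ‖d ξ‖ * ‖d μ * c (ξ - μ)‖ := tsum_mul_left.symm
        _ ≤ ∑' μ, (1 / 2 * (wt ξ * ‖d ξ‖ ^ 2 * ‖c (ξ - μ)‖)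
              + 1 / 2 * (‖d μ‖ ^ 2 * ‖c (ξ - μ)‖)) := by
            refine ((hdc ξ).mul_left _).tsum_le_tsum (fun μ => ?_)
              ((hy.mul_left _).add ((hrow.prod_factor ξ).mul_left _))
            have h3 : |(ξ.1 : ℝ)| * ‖d ξ‖ * ‖d μ‖ ≤
                1 / 2 * (wt ξ * ‖d ξ‖ ^ 2) + 1 / 2 * ‖d μ‖ ^ 2 := by
              have h4 := mul_le_mul_of_nonneg_right (sq_fst_le_wt ξ) (sq_nonneg ‖d ξ‖)
              rw [← sq_abs] at h4
              nlinarith [sq_nonneg (|(ξ.1 : ℝ)| * ‖d ξ‖ - ‖d μ‖)]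
            have h5 := mul_le_mul_of_nonneg_right h3 (norm_nonneg (c (ξ - μ)))
            rw [norm_mul]
            linarith
        _ = 1 / 2 * (wt ξ * ‖d ξ‖ ^ 2 * ∑' μ, ‖c μ‖)
              + 1 / 2 * ∑' μ, ‖d μ‖ ^ 2 * ‖c (ξ - μ)‖ := by
            rw [(hy.mul_left _).tsum_add ((hrow.prod_factor ξ).mul_left _), tsum_mul_left,
              tsum_mul_left, tsum_mul_left, tsum_shift (fun μ => ‖c μ‖)]
        _ ≤ _ := by
            have := mul_le_mul_of_nonneg_left hcΛ (show 0 ≤ wt ξ * ‖d ξ‖ ^ 2 by positivity)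
            linarith
    have h3 := neg_abs_le ((starRingEnd ℂ (d ξ) * (Complex.I * (ξ.1 : ℂ) * N)).re)
    have h4 : -(2 * linearSymbol ε δ β ξ) + Λ / 2 * wt ξ ≤ 2 * S + Λ ^ 2 / ε - Λ / 2 := by
      have h5 : 0 ≤ (ε * wt ξ - Λ) ^ 2 / ε := by positivity
      have e : (ε * wt ξ - Λ) ^ 2 / ε = ε * wt ξ ^ 2 - 2 * Λ * wt ξ + Λ ^ 2 / ε := by
        field_simp; ring
      have h6 := mul_le_mul_of_nonneg_left (one_le_wt ξ) hΛ
      linarith [hlow ξ]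
    have h7 := mul_le_mul_of_nonneg_right h4 (sq_nonneg ‖d ξ‖)
    rw [hre]
    linarith
  have hs1 := hD.mul_left (2 * S + Λ ^ 2 / ε)
  have hs2 := hD.mul_left (Λ / 2)
  have hs3 := hconv.summable.mul_left (1 / 2)
  refine (hr.tsum_le_tsum hpt ((hs1.sub hs2).add hs3)).trans ?_
  rw [(hs1.sub hs2).tsum_add hs3, hs1.tsum_sub hs2, tsum_mul_left, tsum_mul_left, tsum_mul_left,
    hconv.tsum_eq]
  have hD0 : 0 ≤ ∑' ξ, ‖d ξ‖ ^ 2 := tsum_nonneg fun ξ => by positivity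
  have := mul_le_mul_of_nonneg_left hcΛ hD0
  linarith

/-- Oddness in `x` is preserved by the flow: the even part of a solution satisfies a linear
equation with vanishing initial data, and its energy grows at most exponentially. -/
lemma odd (h : ModeSystem ε δ β a) (hε : 0 < ε) (h0 : ∀ ξ, a 0 (reflect ξ) = -a 0 ξ) {t : ℝ}
    (ht : 0 ≤ t) (ξ : ℤ × ℤ) : a t (reflect ξ) = -a t ξ := by
  rcases ht.eq_or_lt with rfl | ht
  · exact h0 ξ
  set d : ℝ → ℤ × ℤ → ℂ := fun t ξ => a t ξ + a t (reflect ξ) with hddef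
  set c : ℝ → ℤ × ℤ → ℂ := fun t ξ => a t ξ - a t (reflect ξ) with hcdef
  set E : ℝ → ℝ := fun t => ∑' ξ, ‖d t ξ‖ ^ 2 with hEdef
  have hrs : ∀ s, 0 ≤ s → Summable fun ξ => ‖a s (reflect ξ)‖ ^ 2 := fun s hs =>
    (reflect.toEquiv.summable_iff (f := fun ξ => ‖a s ξ‖ ^ 2)).2 (h.summable_sq hs)
  have hds : ∀ s, 0 ≤ s → Summable fun ξ => ‖d s ξ‖ ^ 2 := fun s hs =>
    (((h.summable_sq hs).mul_left 2).add ((hrs s hs).mul_left 2)).of_nonneg_of_le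
      (fun _ => by positivity) fun ξ => norm_sq_add_le _ _
  obtain ⟨S, hS, hlow⟩ := exists_symbol_lower ε δ β hε
  obtain ⟨L, hL⟩ := h.exists_bound (t + 1)
  set Λ := 2 * ((∑' ξ, (wt ξ ^ 2)⁻¹) + L)
  set κ := 2 * S + Λ ^ 2 / ε + 1
  have hκ : 0 < κ := by positivity
  have hgrow : ∀ s, 0 < s → s ≤ t → E t ≤ Real.exp (κ * (t - s)) * E s := fun s hs hst => by
    obtain ⟨C, hC⟩ := h.exists_uniform_decay hε (half_pos hs) (t + 1)
    have hsub : ∀ r ∈ Set.Icc s t, r ∈ Set.Ioo (s / 2) (t + 1) := fun r hr =>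
      ⟨by linarith [hr.1], by linarith [hr.2]⟩
    have hdw : ∀ r ∈ Set.Ioo (s / 2) (t + 1), ∀ ξ, wt ξ * ‖d r ξ‖ ≤ 2 * C * decay ξ :=
      fun r hr ξ => by
        have h1 := (hC r (Set.Ioo_subset_Icc_self hr) ξ).1
        have h2 := (hC r (Set.Ioo_subset_Icc_self hr) (reflect ξ)).1
        rw [wt_reflect, show decay (reflect ξ) = decay ξ by rw [decay, wt_reflect, decay]] at h2
        have h3 := mul_le_mul_of_nonneg_left (norm_add_le (a r ξ) (a r (reflect ξ))) (wt_pos ξ).le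
        simp only [hddef]
        linarith
    set r' : ℝ → ℤ × ℤ → ℂ := fun r ξ => rate ε δ β (a r) ξ + rate ε δ β (a r) (reflect ξ)
    have hr' : ∀ r ∈ Set.Ioo (s / 2) (t + 1), ∀ ξ, ‖r' r ξ‖ ≤ 2 * C := fun r hr ξ => by
      have h1 := (hC r (Set.Ioo_subset_Icc_self hr) ξ).2
      have h2 := (hC r (Set.Ioo_subset_Icc_self hr) (reflect ξ)).2
      exact (norm_add_le _ _).trans (by linarith)
    have hdd : ∀ r ∈ Set.Ioo (s / 2) (t + 1), ∀ ξ, ‖d r ξ‖ ≤ 2 * C * decay ξ := fun r hr ξ =>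
      (le_mul_of_one_le_left (norm_nonneg _) (one_le_wt ξ)).trans (hdw r hr ξ)
    have hder : ∀ r ∈ Set.Icc s t, HasDerivAt E
        (∑' ξ, 2 * (starRingEnd ℂ (d r ξ) * r' r ξ).re) r := fun r hr =>
      hasDerivAt_tsum_norm_sq (fun ξ q hq =>
        (h.ode ξ q (by linarith [hq.1])).add (h.ode (reflect ξ) q (by linarith [hq.1])))
        hdd hr' (hsub r hr)
    have hineq : ∀ r ∈ Set.Icc s t,
        ∑' ξ, 2 * (starRingEnd ℂ (d r ξ) * r' r ξ).re ≤ -(-κ) * E r + 0 := fun r hr => by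
      have hr0 : 0 ≤ r := hs.le.trans hr.1
      have e : ∀ ξ, r' r ξ = -(Complex.I * (ξ.1 : ℂ) * (1 / 2 * ∑' μ, d r μ * c r (ξ - μ))
          + (linearSymbol ε δ β ξ : ℂ) * d r ξ) := fun ξ => by
        have := halfSq_sub_reflect (h.summable_sq hr0) ξ
        simp only [hddef, hcdef, r', rate, linearSymbol_reflect, reflect_fst]
        rw [← this]
        push_cast
        ring
      have hsm : Summable fun ξ => 2 * (starRingEnd ℂ (d r ξ) * r' r ξ).re := by
        refine Summable.of_norm_bounded
          (g := fun ξ => 2 * (2 * C * (2 * C)) * decay ξ) (summable_decay.mul_left _) fun ξ => ?_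
        rw [norm_mul, Real.norm_eq_abs, Real.norm_eq_abs, abs_two]
        have h1 := Complex.abs_re_le_norm (starRingEnd ℂ (d r ξ) * r' r ξ)
        rw [norm_mul, RCLike.norm_conj] at h1
        have h2 := mul_le_mul (hdd r (hsub r hr) ξ) (hr' r (hsub r hr) ξ) (norm_nonneg _)
          ((norm_nonneg _).trans (hdd r (hsub r hr) ξ))
        linarith
      simp only [e] at hsm ⊢
      obtain ⟨hsa, hsl⟩ := summable_of_wt (h.summable r hr0)
      have hsa' : Summable fun ξ => ‖a r (reflect ξ)‖ :=
        (reflect.toEquiv.summable_iff (f := fun ξ => ‖a r ξ‖)).2 hsa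
      have hre : ∑' ξ, ‖a r (reflect ξ)‖ = ∑' ξ, ‖a r ξ‖ :=
        reflect.toEquiv.tsum_eq fun ξ => ‖a r ξ‖
      have hcs : Summable fun ξ => ‖c r ξ‖ :=
        (hsa.add hsa').of_nonneg_of_le (fun _ => norm_nonneg _) fun ξ => norm_sub_le _ _
      rw [neg_neg, add_zero]
      refine energy_even_part_le hε hlow (hdw r (hsub r hr)) hcs ?_ hsm
      calc _ ≤ ∑' ξ, (‖a r ξ‖ + ‖a r (reflect ξ)‖) :=
            hcs.tsum_le_tsum (fun ξ => norm_sub_le _ _) (hsa.add hsa')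
        _ = 2 * ∑' ξ, ‖a r ξ‖ := by rw [hsa.tsum_add hsa', hre]; ring
        _ ≤ _ := by
            have := hL r ⟨hr0, by linarith [hr.2]⟩
            simp only [Λ]
            linarith
    have := gronwall_linear (f := E) (neg_ne_zero.2 hκ.ne') hder hineq
      (Set.right_mem_Icc.2 hst)
    simpa using this
  -- the energy tends to zero at the initial time
  have hE0 : Tendsto E (𝓝[>] 0) (𝓝 0) := by
    have h1 : Tendsto (fun s => 4 * ∑' ξ, wt ξ ^ 2 * ‖a s ξ - a 0 ξ‖ ^ 2) (𝓝[>] 0) (𝓝 0) := by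
      have := ((h.tendsto 0 le_rfl).mono_left
        (nhdsWithin_mono _ Set.Ioi_subset_Ici_self)).const_mul (4 : ℝ)
      rwa [mul_zero] at this
    refine squeeze_zero' (Eventually.of_forall fun s => tsum_nonneg fun ξ => by positivity) ?_ h1
    filter_upwards [self_mem_nhdsWithin] with s hs
    have hs0 : 0 ≤ s := le_of_lt hs
    have hq := h.summable_sub hs0 le_rfl
    have hq' : Summable fun ξ => wt ξ ^ 2 * ‖a s (reflect ξ) - a 0 (reflect ξ)‖ ^ 2 := by
      have := (reflect.toEquiv.summable_iff
        (f := fun ξ => wt ξ ^ 2 * ‖a s ξ - a 0 ξ‖ ^ 2)).2 hq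
      refine this.congr fun ξ => ?_
      simp [wt_reflect]
    have hqe : ∑' ξ, wt ξ ^ 2 * ‖a s (reflect ξ) - a 0 (reflect ξ)‖ ^ 2 =
        ∑' ξ, wt ξ ^ 2 * ‖a s ξ - a 0 ξ‖ ^ 2 := by
      rw [← reflect.toEquiv.tsum_eq fun ξ => wt ξ ^ 2 * ‖a s ξ - a 0 ξ‖ ^ 2]
      exact tsum_congr fun ξ => by simp [wt_reflect]
    calc E s ≤ ∑' ξ, (2 * (wt ξ ^ 2 * ‖a s ξ - a 0 ξ‖ ^ 2)
          + 2 * (wt ξ ^ 2 * ‖a s (reflect ξ) - a 0 (reflect ξ)‖ ^ 2)) := by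
          refine (hds s hs0).tsum_le_tsum (fun ξ => ?_) ((hq.mul_left 2).add (hq'.mul_left 2))
          have e : d s ξ = (a s ξ - a 0 ξ) + (a s (reflect ξ) - a 0 (reflect ξ)) := by
            simp only [hddef]; rw [h0]; ring
          have h2 := norm_sq_add_le (a s ξ - a 0 ξ) (a s (reflect ξ) - a 0 (reflect ξ))
          have h3 : 1 ≤ wt ξ ^ 2 := one_le_pow₀ (one_le_wt ξ)
          rw [e]
          nlinarith [sq_nonneg ‖a s ξ - a 0 ξ‖, sq_nonneg ‖a s (reflect ξ) - a 0 (reflect ξ)‖]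
      _ = _ := by
          rw [(hq.mul_left 2).tsum_add (hq'.mul_left 2), tsum_mul_left, tsum_mul_left, hqe]
          ring
  have hlim : Tendsto (fun s => Real.exp (κ * (t - s)) * E s) (𝓝[>] 0) (𝓝 0) := by
    have h1 : Tendsto (fun s => Real.exp (κ * (t - s))) (𝓝[>] 0) (𝓝 (Real.exp (κ * (t - 0)))) :=
      (Continuous.tendsto (by fun_prop) 0).mono_left nhdsWithin_le_nhds
    simpa using h1.mul hE0
  have hEt : E t ≤ 0 := ge_of_tendsto hlim (by
    filter_upwards [Ioc_mem_nhdsGT ht] with s hs using hgrow s hs.1 hs.2)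
  have h1 := ((hds t ht.le).le_tsum ξ (fun _ _ => by positivity)).trans hEt
  have h2 : ‖d t ξ‖ = 0 := by nlinarith [norm_nonneg (d t ξ)]
  have h3 : a t ξ + a t (reflect ξ) = 0 := norm_eq_zero.1 h2
  exact eq_neg_of_add_eq_zero_right h3

end ModeSystem

/-! ### Conservation of energy by the transport term -/

/-- `∫ u² uₓ = 0` for real-valued `u`: the cubic form is the average of three copies of itself with
frequency factors `κ₁`, `μ₁`, `-κ₁ - μ₁`, whose sum is zero. -/
lemma tsum_transport_eq_zero {a : ℤ × ℤ → ℂ} {C : ℝ}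
    (hconj : ∀ ξ, a (-ξ) = starRingEnd ℂ (a ξ)) (ha : ∀ ξ, wt ξ * ‖a ξ‖ ≤ C * decay ξ) :
    HasSum (fun ξ => starRingEnd ℂ (a ξ) * (Complex.I * (ξ.1 : ℂ) * halfSq a ξ)) 0 := by
  have hC : 0 ≤ C := nonneg_of_mul_nonneg_left
    ((mul_nonneg (wt_pos 0).le (norm_nonneg _)).trans (ha 0)) (decay_pos 0)
  have ha' : ∀ ξ, ‖a ξ‖ ≤ C * decay ξ := fun ξ =>
    (le_mul_of_one_le_left (norm_nonneg _) (one_le_wt ξ)).trans (ha ξ)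
  set h : (ℤ × ℤ) × (ℤ × ℤ) → ℂ := fun p => a p.1 * a p.2 * a (-p.1 - p.2) with hh
  set G : (ℤ × ℤ) × (ℤ × ℤ) → ℂ := fun p => (p.1.1 : ℂ) * h p with hG
  have hGs : Summable G := by
    refine Summable.of_norm_bounded (g := fun p => C ^ 3 * (decay p.1 * decay p.2))
      ((summable_decay.mul_of_nonneg summable_decay (fun ξ => (decay_pos ξ).le)
        (fun ξ => (decay_pos ξ).le)).mul_left _) fun p => ?_
    have h1 : |(p.1.1 : ℝ)| ≤ wt p.1 := by
      have := sq_fst_le_wt p.1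
      rw [← sq_abs] at this
      nlinarith [abs_nonneg (p.1.1 : ℝ), one_le_wt p.1]
    have h2 : |(p.1.1 : ℝ)| * ‖a p.1‖ ≤ C * decay p.1 :=
      (mul_le_mul_of_nonneg_right h1 (norm_nonneg _)).trans (ha _)
    have h3 : ‖a (-p.1 - p.2)‖ ≤ C :=
      (ha' _).trans (mul_le_of_le_one_right hC (decay_le_one _))
    have e : ‖G p‖ = |(p.1.1 : ℝ)| * ‖a p.1‖ * ‖a p.2‖ * ‖a (-p.1 - p.2)‖ := by
      simp [hG, hh]; ring
    have d1 := decay_pos p.1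
    have d2 := decay_pos p.2
    rw [e]
    calc _ ≤ C * decay p.1 * (C * decay p.2) * C :=
          mul_le_mul (mul_le_mul h2 (ha' _) (norm_nonneg _) (by positivity)) h3 (norm_nonneg _)
            (by positivity)
      _ = _ := by ring
  have hswap : ∑' p, (p.2.1 : ℂ) * h p = ∑' p, G p := by
    rw [← (Equiv.prodComm _ _).tsum_eq G]
    refine tsum_congr fun p => ?_
    simp only [hG, hh, Equiv.prodComm_apply, Prod.fst_swap, Prod.snd_swap]
    rw [show -p.2 - p.1 = -p.1 - p.2 by abel]
    ring
  have hswap_s : Summable fun p => (p.2.1 : ℂ) * h p := by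
    refine ((Equiv.prodComm _ _).summable_iff.2 hGs).congr fun p => ?_
    simp only [hG, hh, Equiv.prodComm_apply, Prod.fst_swap, Prod.snd_swap, Function.comp]
    rw [show -p.2 - p.1 = -p.1 - p.2 by abel]
    ring
  let e : (ℤ × ℤ) × (ℤ × ℤ) ≃ (ℤ × ℤ) × (ℤ × ℤ) :=
    { toFun := fun p => (-p.1 - p.2, p.2)
      invFun := fun p => (-p.1 - p.2, p.2)
      left_inv := fun p => by simp
      right_inv := fun p => by simp }
  have hrot : ∑' p, G p = -(∑' p, G p) - ∑' p, (p.2.1 : ℂ) * h p := by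
    conv_lhs => rw [← e.tsum_eq G]
    rw [← tsum_neg, ← hGs.neg.tsum_sub hswap_s]
    refine tsum_congr fun p => ?_
    simp only [hG, hh, e, Equiv.coe_fn_mk, Prod.fst_sub, Prod.fst_neg]
    rw [show -(-p.1 - p.2) - p.2 = p.1 by abel]
    push_cast
    ring
  have hX : ∑' p, G p = 0 := by
    rw [hswap] at hrot
    linear_combination (1 / 3 : ℂ) * hrot
  have hfib := (hGs.hasSum.prod_fiberwise fun ξ => (hGs.prod_factor ξ).hasSum)
  rw [hX] at hfib
  have hneg := ((Equiv.neg (ℤ × ℤ)).hasSum_iff.2 hfib).mul_left (-(Complex.I / 2))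
  rw [mul_zero] at hneg
  convert! hneg using 1
  funext ξ
  have e1 : ∑' μ, G (-ξ, μ) = -(ξ.1 : ℂ) * a (-ξ) * ∑' μ, a μ * a (ξ - μ) := by
    rw [← tsum_mul_left]
    refine tsum_congr fun μ => ?_
    simp only [hG, hh, Prod.fst_neg, neg_neg]
    push_cast
    ring
  simp only [Function.comp, Equiv.neg_apply]
  rw [e1, ← hconj, halfSq]
  ring

/-! ### The window sums of an odd sequence -/

lemma summable_one_add_sq_rpow_nat :
    Summable fun k : ℕ => (1 + (k : ℝ) ^ 2) ^ (-(5 / 8) : ℝ) := by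
  have h1 : Summable fun m : ℕ => (m : ℝ) ^ (-(5 / 4) : ℝ) := Real.summable_nat_rpow.2 (by norm_num)
  rw [← summable_nat_add_iff 1] at h1 ⊢
  refine h1.of_nonneg_of_le (fun m => by positivity) fun m => ?_
  have h0 : (0 : ℝ) < ((m + 1 : ℕ) : ℝ) := by positivity
  have : ((m + 1 : ℕ) : ℝ) ^ (-(5 / 4) : ℝ) = (((m + 1 : ℕ) : ℝ) ^ 2) ^ (-(5 / 8) : ℝ) := by
    rw [← Real.rpow_natCast, ← Real.rpow_mul h0.le]; norm_num
  rw [this]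
  exact Real.rpow_le_rpow_of_nonpos (by positivity) (by linarith) (by norm_num)

/-- For an odd sequence `r` on `ℤ` with `|r m| ≤ h (1 + m²)⁻¹`, the sums of `r` over windows of any
length `n` are bounded by a square summable sequence that does not depend on `n`. By oddness, a sum
over a half-line `[p, ∞)` is also a sum over `[|p|, ∞)` or `[|p| + 1, ∞)`. -/
lemma exists_window_bound : ∃ C : ℝ, 0 < C ∧ ∀ (r : ℤ → ℂ) (h : ℝ), (∀ m, r (-m) = -r m) →
    (∀ m, ‖r m‖ ≤ h * (1 + (m : ℝ) ^ 2)⁻¹) → ∀ (n : ℕ) (p : ℤ),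
      ‖∑ i ∈ Finset.range n, r (p + i)‖ ^ 2 ≤ C * h ^ 2 *
        ((1 + (p : ℝ) ^ 2) ^ (-(3 / 4) : ℝ) + (1 + ((p + n : ℤ) : ℝ) ^ 2) ^ (-(3 / 4) : ℝ)) := by
  set Z := ∑' k : ℕ, (1 + (k : ℝ) ^ 2) ^ (-(5 / 8) : ℝ)
  have hZ : 0 < Z := summable_one_add_sq_rpow_nat.tsum_pos (fun k => by positivity) 0 (by simp)
  refine ⟨2 * Z ^ 2, by positivity, fun r h hodd hr n p => ?_⟩
  have hh : 0 ≤ h := by simpa using (norm_nonneg _).trans (hr 0)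
  -- the exponent `1` is split into `3/8 + 5/8`: the factor `(1 + k²)^(-5/8)` is summable in `k`,
  -- and the square of the factor `(1 + p²)^(-3/8)` is summable in `p`
  have hpt : ∀ (p : ℤ), 0 ≤ p → ∀ k : ℕ, ‖r (p + k)‖ ≤
      h * (1 + (p : ℝ) ^ 2) ^ (-(3 / 8) : ℝ) * (1 + (k : ℝ) ^ 2) ^ (-(5 / 8) : ℝ) :=
      fun p hp k => by
    have hp' : (0 : ℝ) ≤ p := by exact_mod_cast hp
    refine (hr _).trans ?_
    rw [mul_assoc]
    refine mul_le_mul_of_nonneg_left ?_ hh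
    have hpos : (0 : ℝ) < 1 + ((p + k : ℤ) : ℝ) ^ 2 := by positivity
    have e : (1 + ((p + k : ℤ) : ℝ) ^ 2)⁻¹ = (1 + ((p + k : ℤ) : ℝ) ^ 2) ^ (-(3 / 8) : ℝ)
        * (1 + ((p + k : ℤ) : ℝ) ^ 2) ^ (-(5 / 8) : ℝ) := by
      rw [← Real.rpow_add hpos, ← Real.rpow_neg_one]; norm_num
    have hk : (0 : ℝ) ≤ k := Nat.cast_nonneg k
    rw [e]
    refine mul_le_mul (Real.rpow_le_rpow_of_nonpos (by positivity) ?_ (by norm_num))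
      (Real.rpow_le_rpow_of_nonpos (by positivity) ?_ (by norm_num)) (by positivity) (by positivity)
    all_goals push_cast; nlinarith
  have hsum0 : ∀ p : ℤ, 0 ≤ p → Summable fun k : ℕ => r (p + k) := fun p hp =>
    Summable.of_norm_bounded (summable_one_add_sq_rpow_nat.mul_left _) (hpt p hp)
  have hsum : ∀ p : ℤ, Summable fun k : ℕ => r (p + k) := fun p => by
    rw [← summable_nat_add_iff p.natAbs]
    refine (hsum0 (p + p.natAbs) (by omega)).congr fun k => ?_
    congr 1; push_cast; ring
  set τ : ℤ → ℂ := fun p => ∑' k : ℕ, r (p + k)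
  have hstep : ∀ p, τ p = r p + τ (p + 1) := fun p => by
    simp only [τ]
    rw [(hsum p).tsum_eq_zero_add]
    congr 1
    · simp
    · refine tsum_congr fun k => ?_
      congr 1; push_cast; ring
  have hwin : ∑ i ∈ Finset.range n, r (p + i) = τ p - τ (p + n) := by
    induction n with
    | zero => simp
    | succ n ih =>
      rw [Finset.sum_range_succ, ih, hstep (p + n)]
      push_cast
      rw [add_assoc p]
      ring
  have hr0 : r 0 = 0 := by
    have := hodd 0
    rw [neg_zero] at this
    exact self_eq_neg.1 this
  -- the terms with index in `[-k, k]` cancel in pairs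
  have hrefl : ∀ k : ℕ, τ (-k) = τ (1 + k) := fun k => by
    induction k with
    | zero => simpa [hr0] using hstep 0
    | succ k ih =>
      have h1 := hstep (-((k + 1 : ℕ) : ℤ))
      rw [hodd, show -((k + 1 : ℕ) : ℤ) + 1 = -k by push_cast; ring, ih] at h1
      have h2 := hstep (1 + k)
      rw [h1, h2, show (1 + (k : ℤ)) + 1 = 1 + ((k + 1 : ℕ) : ℤ) by push_cast; ring,
        show ((k + 1 : ℕ) : ℤ) = 1 + k by push_cast; ring]
      ring
  have htail0 : ∀ p : ℤ, 0 ≤ p → ‖τ p‖ ≤ h * (1 + (p : ℝ) ^ 2) ^ (-(3 / 8) : ℝ) * Z :=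
    fun p hp => (tsum_of_norm_bounded (summable_one_add_sq_rpow_nat.mul_left _).hasSum
      (hpt p hp)).trans_eq tsum_mul_left
  have htail : ∀ p : ℤ, ‖τ p‖ ≤ h * (1 + (p : ℝ) ^ 2) ^ (-(3 / 8) : ℝ) * Z := fun p => by
    rcases le_total 0 p with hp | hp
    · exact htail0 p hp
    · obtain ⟨k, rfl⟩ : ∃ k : ℕ, p = -k := ⟨p.natAbs, by omega⟩
      rw [hrefl]
      refine (htail0 _ (by positivity)).trans ?_
      refine mul_le_mul_of_nonneg_right (mul_le_mul_of_nonneg_left ?_ hh) hZ.le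
      refine Real.rpow_le_rpow_of_nonpos (by positivity) ?_ (by norm_num)
      have hk : (0 : ℝ) ≤ k := Nat.cast_nonneg k
      push_cast
      nlinarith
  have htail2 : ∀ p : ℤ, ‖τ p‖ ^ 2 ≤ Z ^ 2 * h ^ 2 * (1 + (p : ℝ) ^ 2) ^ (-(3 / 4) : ℝ) :=
      fun p => by
    refine (pow_le_pow_left₀ (norm_nonneg _) (htail p) 2).trans (le_of_eq ?_)
    have e : (1 + (p : ℝ) ^ 2) ^ (-(3 / 4) : ℝ) = ((1 + (p : ℝ) ^ 2) ^ (-(3 / 8) : ℝ)) ^ 2 := by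
      rw [← Real.rpow_natCast ((1 + (p : ℝ) ^ 2) ^ (-(3 / 8) : ℝ)) 2,
        ← Real.rpow_mul (by positivity)]
      norm_num
    rw [e]; ring
  rw [hwin]
  have h1 := norm_sub_le (τ p) (τ (p + n))
  have h2 : ‖τ p - τ (p + n)‖ ^ 2 ≤ 2 * ‖τ p‖ ^ 2 + 2 * ‖τ (p + n)‖ ^ 2 := by
    nlinarith [norm_nonneg (τ p - τ (p + n)), sq_nonneg (‖τ p‖ - ‖τ (p + n)‖),
      norm_nonneg (τ p), norm_nonneg (τ (p + n))]
  have h3 := htail2 p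
  have h4 := htail2 (p + n)
  linarith

/-- The sum of `a` over the horizontal window of length `n` that starts at `μ`: these are the
Fourier coefficients of the product of `u` with a Dirichlet kernel in `x`. -/
def windowSum (a : ℤ × ℤ → ℂ) (n : ℕ) (μ : ℤ × ℤ) : ℂ := ∑ i ∈ Finset.range n, a (μ + ((i : ℤ), 0))

/-- A function that is odd in `x` vanishes at `x = 0`, where the Fejér kernels concentrate. In
Fourier variables: its window sums are controlled by the `H²` norm, uniformly in the length. -/
lemma exists_tsum_windowSum_le : ∃ C : ℝ, 0 < C ∧ ∀ a : ℤ × ℤ → ℂ,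
    (∀ ξ, a (reflect ξ) = -a ξ) → Summable (fun ξ => wt ξ ^ 2 * ‖a ξ‖ ^ 2) → ∀ n : ℕ,
      ∑' μ, ‖windowSum a n μ‖ ^ 2 ≤ C * ∑' ξ, wt ξ ^ 2 * ‖a ξ‖ ^ 2 := by
  obtain ⟨C, hC, hwin⟩ := exists_window_bound
  set θ : ℤ → ℝ := fun m => (1 + (m : ℝ) ^ 2) ^ (-(3 / 4) : ℝ)
  have hθ : Summable θ := summable_one_add_sq_rpow
  have hθ0 : ∀ m, 0 ≤ θ m := fun m => by positivity
  have hΘ : 0 < ∑' m, θ m := hθ.tsum_pos hθ0 0 (by simp [θ])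
  refine ⟨C * (2 * ∑' m, θ m), by positivity, fun a hodd ha n => ?_⟩
  have ha' : Summable fun p : ℤ × ℤ => wt (p.2, p.1) ^ 2 * ‖a (p.2, p.1)‖ ^ 2 :=
    (Equiv.prodComm ℤ ℤ).summable_iff.2 ha
  set H : ℤ → ℝ := fun j => ∑' m, wt (m, j) ^ 2 * ‖a (m, j)‖ ^ 2
  have hH0 : ∀ j, 0 ≤ H j := fun j => tsum_nonneg fun m => by positivity
  have hHs : HasSum H (∑' ξ, wt ξ ^ 2 * ‖a ξ‖ ^ 2) := by
    have h1 := ha'.hasSum.prod_fiberwise fun j => (ha'.prod_factor j).hasSum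
    rwa [show ∑' p : ℤ × ℤ, wt (p.2, p.1) ^ 2 * ‖a (p.2, p.1)‖ ^ 2 = ∑' ξ, wt ξ ^ 2 * ‖a ξ‖ ^ 2
      from (Equiv.prodComm ℤ ℤ).tsum_eq fun ξ => wt ξ ^ 2 * ‖a ξ‖ ^ 2] at h1
  have hrow : ∀ j m : ℤ, ‖a (m, j)‖ ≤ Real.sqrt (H j) * (1 + (m : ℝ) ^ 2)⁻¹ := fun j m => by
    have h1 : (wt (m, j) * ‖a (m, j)‖) ^ 2 ≤ H j := by
      rw [mul_pow]
      exact (ha'.prod_factor j).le_tsum m (fun _ _ => by positivity)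
    have h2 := Real.le_sqrt_of_sq_le h1
    have h3 : (1 + (m : ℝ) ^ 2) ≤ wt (m, j) := by
      simp only [wt, freqSq]; nlinarith [sq_nonneg (j : ℝ)]
    rw [← div_eq_mul_inv, le_div_iff₀ (by positivity), mul_comm]
    exact (mul_le_mul_of_nonneg_right h3 (norm_nonneg _)).trans h2
  have hθn : Summable fun m : ℤ => θ (m + n) := (Equiv.addRight (n : ℤ)).summable_iff.2 hθ
  have hθn' : ∑' m : ℤ, θ (m + n) = ∑' m, θ m := (Equiv.addRight (n : ℤ)).tsum_eq θ
  have hprod := (hθ.add hθn).mul_of_nonneg hHs.summable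
    (fun m => add_nonneg (hθ0 _) (hθ0 _)) hH0
  have hb : ∀ μ : ℤ × ℤ, ‖windowSum a n μ‖ ^ 2 ≤ C * ((θ μ.1 + θ (μ.1 + n)) * H μ.2) :=
    fun μ => by
      have h1 := hwin (fun m => a (m, μ.2)) (Real.sqrt (H μ.2))
        (fun m => hodd (m, μ.2)) (hrow μ.2) n μ.1
      rw [Real.sq_sqrt (hH0 _)] at h1
      have e : windowSum a n μ = ∑ i ∈ Finset.range n, a (μ.1 + i, μ.2) := by
        refine Finset.sum_congr rfl fun i _ => ?_
        congr 1
        ext <;> simp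
      rw [e]
      refine h1.trans_eq ?_
      simp only [θ]
      ring
  have hws : Summable fun μ => ‖windowSum a n μ‖ ^ 2 :=
    (hprod.mul_left C).of_nonneg_of_le (fun _ => by positivity) hb
  refine (hws.tsum_le_tsum hb (hprod.mul_left C)).trans_eq ?_
  rw [tsum_mul_left, ← (hθ.add hθn).tsum_mul_tsum hHs.summable hprod, hθ.tsum_add hθn, hθn',
    hHs.tsum_eq]
  ring

/-- The Fejér kernel identity `∫ F u² = (1/n) ∫ |D u|²`, with `F` the Fejér and `D` the Dirichlet
kernel in `x`, both of length `n`. -/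
lemma sum_halfSq_eq_tsum_windowSum {a : ℤ × ℤ → ℂ} (hconj : ∀ ξ, a (-ξ) = starRingEnd ℂ (a ξ))
    (ha : Summable fun ξ => ‖a ξ‖ ^ 2) (n : ℕ) :
    ∑ i ∈ Finset.range n, ∑ j ∈ Finset.range n, halfSq a ((i : ℤ) - (j : ℤ), 0) =
      ((1 / 2 * ∑' μ, ‖windowSum a n μ‖ ^ 2 : ℝ) : ℂ) := by
  have hsh : ∀ ν : ℤ × ℤ, Summable fun μ => ‖a (μ + ν)‖ ^ 2 := fun ν =>
    (Equiv.addRight ν).summable_iff.2 ha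
  have hs : ∀ i j : ℕ, Summable fun μ =>
      a (μ + ((i : ℤ), 0)) * starRingEnd ℂ (a (μ + ((j : ℤ), 0))) :=
    fun i j => by
      refine Summable.of_norm ?_
      refine ((hsh ((i : ℤ), 0)).add (hsh ((j : ℤ), 0))).of_nonneg_of_le
        (fun _ => norm_nonneg _) fun μ => ?_
      rw [norm_mul, RCLike.norm_conj]
      nlinarith [sq_nonneg (‖a (μ + ((i : ℤ), 0))‖ - ‖a (μ + ((j : ℤ), 0))‖),
        sq_nonneg (‖a (μ + ((i : ℤ), 0))‖),
        sq_nonneg (‖a (μ + ((j : ℤ), 0))‖)]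
  have h1 : ∀ i j : ℕ, halfSq a ((i : ℤ) - (j : ℤ), 0) =
      1 / 2 * ∑' μ, a (μ + ((i : ℤ), 0)) * starRingEnd ℂ (a (μ + ((j : ℤ), 0))) := fun i j => by
    rw [halfSq, ← (Equiv.addRight ((i : ℤ), (0 : ℤ))).tsum_eq]
    congr 1
    refine tsum_congr fun μ => ?_
    rw [← hconj]
    congr 2
    ext <;> simp
    ring
  simp_rw [h1]
  rw [Complex.ofReal_mul, Complex.ofReal_tsum]
  simp_rw [← Finset.mul_sum]
  congr 1
  · simp
  · rw [Finset.sum_congr rfl fun i _ => (Summable.tsum_finsetSum fun j _ => hs i j).symm,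
      ← Summable.tsum_finsetSum fun i _ => summable_sum fun j _ => hs i j]
    refine tsum_congr fun μ => ?_
    rw [Complex.ofReal_pow, ← Complex.mul_conj', windowSum, map_sum, Finset.sum_mul_sum]

/-! ### The absorbing ball in `L²` -/

/-- The pairing `-λ⁻¹ ∫ φ u`, with respect to the normalised measure of the torus, with a
real function `φ(x)` such that `φ' = λ (1 - F)`, where `F` is the Fejér kernel of length `n`. The
summands with `i = j` vanish because `I / 0 = 0`, as they should: `φ'` has mean zero. -/
def gauge (n : ℕ) (a : ℤ × ℤ → ℂ) : ℂ :=
  (n : ℂ)⁻¹ * ∑ i ∈ Finset.range n, ∑ j ∈ Finset.range n,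
    Complex.I / (((i : ℤ) - (j : ℤ) : ℤ) : ℂ) * a ((i : ℤ) - (j : ℤ), 0)

lemma exists_norm_gauge_le (n : ℕ) (g : ℤ × ℤ → ℝ) : ∃ K : ℝ, 0 ≤ K ∧ ∀ a : ℤ × ℤ → ℂ,
    Summable (fun ξ => ‖a ξ‖ ^ 2) →
      ‖gauge n (fun ξ => g ξ * a ξ)‖ ≤ K * Real.sqrt (∑' ξ, ‖a ξ‖ ^ 2) := by
  refine ⟨‖(n : ℂ)⁻¹‖ * ∑ i ∈ Finset.range n, ∑ j ∈ Finset.range n,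
    ‖Complex.I / (((i : ℤ) - (j : ℤ) : ℤ) : ℂ)‖ * |g ((i : ℤ) - (j : ℤ), 0)|,
    by positivity, fun a ha => ?_⟩
  rw [gauge, norm_mul, mul_assoc, Finset.sum_mul]
  refine mul_le_mul_of_nonneg_left ?_ (norm_nonneg _)
  refine (norm_sum_le _ _).trans (Finset.sum_le_sum fun i _ => ?_)
  rw [Finset.sum_mul]
  refine (norm_sum_le _ _).trans (Finset.sum_le_sum fun j _ => ?_)
  rw [norm_mul, norm_mul, Complex.norm_real, Real.norm_eq_abs, mul_assoc]
  refine mul_le_mul_of_nonneg_left (mul_le_mul_of_nonneg_left ?_ (abs_nonneg _)) (norm_nonneg _)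
  exact Real.le_sqrt_of_sq_le (ha.le_tsum _ fun _ _ => by positivity)

/-- Along the flow the pairing with `φ` produces `-λ⁻¹ ∫ φ' u² / 2`, up to a linear term. -/
lemma gauge_rate {ε δ β : ℝ} {n : ℕ} (hn : 0 < n) {a : ℤ × ℤ → ℂ}
    (hconj : ∀ ξ, a (-ξ) = starRingEnd ℂ (a ξ)) (ha : Summable fun ξ => ‖a ξ‖ ^ 2) :
    gauge n (rate ε δ β a) = ((1 / (2 * n) * ∑' μ, ‖windowSum a n μ‖ ^ 2 : ℝ) : ℂ)
      - ((1 / 2 * ∑' ξ, ‖a ξ‖ ^ 2 : ℝ) : ℂ)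
      - gauge n (fun ξ => (linearSymbol ε δ β ξ : ℝ) * a ξ) := by
  have hn' : (n : ℂ) ≠ 0 := by exact_mod_cast hn.ne'
  have h0 : halfSq a 0 = ((1 / 2 * ∑' ξ, ‖a ξ‖ ^ 2 : ℝ) : ℂ) := by
    rw [halfSq, Complex.ofReal_mul, Complex.ofReal_tsum]
    congr 1
    · simp
    · refine tsum_congr fun μ => ?_
      rw [zero_sub, hconj, Complex.mul_conj']
      simp
  have hterm : ∀ i j : ℕ, Complex.I / (((i : ℤ) - (j : ℤ) : ℤ) : ℂ) *
      rate ε δ β a ((i : ℤ) - (j : ℤ), 0) =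
      halfSq a ((i : ℤ) - (j : ℤ), 0) - (if i = j then halfSq a 0 else 0)
        - Complex.I / (((i : ℤ) - (j : ℤ) : ℤ) : ℂ) *
          ((linearSymbol ε δ β ((i : ℤ) - (j : ℤ), 0) : ℝ) * a ((i : ℤ) - (j : ℤ), 0)) :=
    fun i j => by
      by_cases hij : i = j
      · subst hij
        simp only [sub_self, Int.cast_zero, div_zero, zero_mul, if_true, sub_zero]
        rw [Prod.mk_zero_zero, sub_self]
      · have hk : (((i : ℤ) - (j : ℤ) : ℤ) : ℂ) ≠ 0 := by
          rw [Int.cast_ne_zero]; omega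
        rw [if_neg hij, sub_zero, rate]
        field_simp
        linear_combination (-(((i : ℤ) - (j : ℤ) : ℤ) : ℂ) *
          halfSq a ((i : ℤ) - (j : ℤ), 0)) * Complex.I_sq
  have hsum := sum_halfSq_eq_tsum_windowSum hconj ha n
  simp only [gauge, hterm, Finset.sum_sub_distrib]
  rw [hsum, ← h0]
  simp only [Finset.sum_ite_eq, Finset.mem_range]
  rw [Finset.sum_congr rfl fun i hi => if_pos (Finset.mem_range.1 hi), Finset.sum_const,
    Finset.card_range, nsmul_eq_mul]
  push_cast
  field_simp

namespace ModeSystem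

/-- The `L²` norm of an odd solution is eventually bounded by a constant that depends only on the
parameters. The Lyapunov function is `‖u‖² / 2 - ∫ φ u` with `φ' = λ (1 - F)`: the constant part of
`φ'` gives damping at the large rate `λ`, and the part `F` that compensates it acts near `x = 0`,
where `u` vanishes. -/
lemma exists_energy_decay {ε : ℝ} (δ β : ℝ) (hε : 0 < ε) :
    ∃ K : ℝ, 0 ≤ K ∧ ∀ a, ModeSystem ε δ β a →
      (∀ t, 0 ≤ t → ∀ ξ, a t (reflect ξ) = -a t ξ) → ∀ s t : ℝ, 0 < s → s ≤ t →
        ∑' ξ, ‖a t ξ‖ ^ 2 ≤ 4 * Real.exp (-(t - s)) * ∑' ξ, ‖a s ξ‖ ^ 2 + K := by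
  obtain ⟨S, hS, hlow⟩ := exists_symbol_lower ε δ β hε
  obtain ⟨C, hC, hwin⟩ := exists_tsum_windowSum_le
  -- `L` beats the growth rate of the unstable modes; then `n` makes the Fejér part small
  set L := 2 * (S + 2) with hLdef
  have hL : 0 < L := by positivity
  obtain ⟨n, hn⟩ := exists_nat_ge (L * C / ε + 1)
  have hn0 : (1 : ℝ) ≤ n := le_trans (by have : 0 ≤ L * C / ε := by positivity
                                         linarith) hn
  have hnpos : 0 < n := by exact_mod_cast zero_lt_one.trans_le hn0
  have hnC : L * C / (2 * n) ≤ ε / 2 := by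
    rw [div_le_iff₀ (by positivity)]
    have : L * C / ε * ε ≤ n * ε := mul_le_mul_of_nonneg_right (by linarith) hε.le
    rw [div_mul_cancel₀ _ hε.ne'] at this
    linarith
  obtain ⟨K1, hK1, hg1⟩ := exists_norm_gauge_le n (linearSymbol ε δ β)
  obtain ⟨K2, hK2, hg2⟩ := exists_norm_gauge_le n 1
  set K3 := (L * K1) ^ 2 + (L * K2) ^ 2 with hK3
  refine ⟨4 * ((L * K2) ^ 2 + ((L * K2) ^ 2 + K3)) , by positivity, fun a h hodd s t hs hst => ?_⟩
  set E : ℝ → ℝ := fun t => ∑' ξ, ‖a t ξ‖ ^ 2 with hEdef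
  set F : ℝ → ℝ := fun t => 1 / 2 * E t + L * (gauge n (a t)).re with hFdef
  have hE0 : ∀ t, 0 ≤ E t := fun t => tsum_nonneg fun ξ => by positivity
  have hgE : ∀ r, 0 ≤ r → |L * (gauge n (a r)).re| ≤ 1 / 4 * E r + (L * K2) ^ 2 := fun r hr => by
    have h1 := hg2 (a r) (h.summable_sq hr)
    simp only [Pi.one_apply, Complex.ofReal_one, one_mul] at h1
    have h2 := (Complex.abs_re_le_norm _).trans h1
    rw [abs_mul, abs_of_pos hL]
    have h3 := mul_le_mul_of_nonneg_left h2 hL.le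
    nlinarith [sq_nonneg (1 / 2 * Real.sqrt (E r) - L * K2), Real.sq_sqrt (hE0 r)]
  have hder : ∀ r, 0 < r → HasDerivAt F (1 / 2 * (∑' ξ, 2 * (starRingEnd ℂ (a r ξ) *
      rate ε δ β (a r) ξ).re) + L * (gauge n (rate ε δ β (a r))).re) r := fun r hr => by
    obtain ⟨D, hD⟩ := h.exists_uniform_decay hε (half_pos hr) (r + 1)
    have h1 := hasDerivAt_tsum_norm_sq (s := r / 2) (T := r + 1) (t := r) (C := D)
      (b' := fun q => rate ε δ β (a q))
      (fun ξ q hq => h.ode ξ q (by linarith [hq.1]))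
      (fun q hq ξ => (le_mul_of_one_le_left (norm_nonneg _) (one_le_wt ξ)).trans
        (hD q (Set.Ioo_subset_Icc_self hq) ξ).1)
      (fun q hq ξ => (hD q (Set.Ioo_subset_Icc_self hq) ξ).2) ⟨by linarith, by linarith⟩
    have h2 : HasDerivAt (fun q => gauge n (a q)) (gauge n (rate ε δ β (a r))) r :=
      HasDerivAt.const_mul _ (HasDerivAt.fun_sum fun i _ => HasDerivAt.fun_sum fun j _ =>
        (h.ode _ r hr).const_mul _)
    have h3 : HasDerivAt (fun q => (gauge n (a q)).re) (gauge n (rate ε δ β (a r))).re r :=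
      (Complex.reCLM.hasFDerivAt.comp_hasDerivAt r h2)
    exact (h1.const_mul _).add (h3.const_mul _)
  have hineq : ∀ r, 0 < r → 1 / 2 * (∑' ξ, 2 * (starRingEnd ℂ (a r ξ) *
      rate ε δ β (a r) ξ).re) + L * (gauge n (rate ε δ β (a r))).re ≤ -1 * F r + K3 :=
    fun r hr => by
      obtain ⟨D, hD⟩ := h.exists_uniform_decay hε hr r
      have hsum := h.summable r hr.le
      have hsq := h.summable_sq hr.le
      have hconj := h.conj_neg r hr.le
      have hcanc := tsum_transport_eq_zero hconj fun ξ => (hD r ⟨le_rfl, le_rfl⟩ ξ).1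
      have hcanc' := Complex.hasSum_re hcanc
      set H := ∑' ξ, wt ξ ^ 2 * ‖a r ξ‖ ^ 2
      have hdiss : 1 / 2 * (∑' ξ, 2 * (starRingEnd ℂ (a r ξ) * rate ε δ β (a r) ξ).re) ≤
          S * E r - ε / 2 * H := by
        obtain ⟨M, hM, hup⟩ := exists_symbol_upper ε δ β
        have hls : Summable fun ξ => -linearSymbol ε δ β ξ * ‖a r ξ‖ ^ 2 := by
          refine Summable.of_norm_bounded (hsum.mul_left M) fun ξ => ?_
          rw [norm_mul, norm_neg, Real.norm_eq_abs, Real.norm_of_nonneg (sq_nonneg _)]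
          have := mul_le_mul_of_nonneg_right (hup ξ) (sq_nonneg ‖a r ξ‖)
          linarith
        rw [tsum_mul_left]
        simp_rw [re_conj_mul_rate]
        rw [hls.tsum_sub hcanc'.summable, hcanc'.tsum_eq]
        have h1 := hls.tsum_le_tsum
          (g := fun ξ => S * ‖a r ξ‖ ^ 2 - ε / 2 * (wt ξ ^ 2 * ‖a r ξ‖ ^ 2))
          (fun ξ => by
            have := mul_le_mul_of_nonneg_right (hlow ξ) (sq_nonneg ‖a r ξ‖)
            linarith) ((hsq.mul_left S).sub (hsum.mul_left (ε / 2)))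
        rw [(hsq.mul_left S).tsum_sub (hsum.mul_left (ε / 2)), tsum_mul_left, tsum_mul_left] at h1
        simp only [Complex.zero_re]
        linarith
      have hgr : L * (gauge n (rate ε δ β (a r))).re ≤
          ε / 2 * H - L / 2 * E r + (E r + (L * K1) ^ 2) := by
        rw [gauge_rate hnpos hconj hsq, Complex.sub_re, Complex.sub_re, Complex.ofReal_re,
          Complex.ofReal_re]
        have h1 := hg1 (a r) hsq
        have h2 := (neg_abs_le _).trans' (neg_le_neg ((Complex.abs_re_le_norm _).trans h1))
        have h3 := mul_le_mul_of_nonneg_left (hwin (a r) (hodd r hr.le) hsum n)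
          (show 0 ≤ L * (1 / (2 * (n : ℝ))) by positivity)
        have h4 := mul_le_mul_of_nonneg_right hnC
          (show 0 ≤ H from tsum_nonneg fun ξ => by positivity)
        have e : L * (1 / (2 * (n : ℝ))) * (C * H) = L * C / (2 * n) * H := by ring
        have h5 := mul_le_mul_of_nonneg_left h2 hL.le
        have h6 : L * (K1 * Real.sqrt (E r)) ≤ E r + (L * K1) ^ 2 := by
          nlinarith [sq_nonneg (Real.sqrt (E r) - L * K1), Real.sq_sqrt (hE0 r),
            sq_nonneg (L * K1), hE0 r]
        simp only [hEdef] at h6 ⊢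
        linarith
      have h7 := (le_abs_self _).trans (hgE r hr.le)
      have := hE0 r
      simp only [hFdef, hK3]
      rw [hLdef] at hgr h7 ⊢
      nlinarith
  have hG := gronwall_linear (f := F) (c := 1) (K := K3) (s := s) (T := t) one_ne_zero
    (fun r hr => hder r (hs.trans_le hr.1)) (fun r hr => hineq r (hs.trans_le hr.1))
    (Set.right_mem_Icc.2 hst)
  rw [div_one, neg_one_mul] at hG
  have h1 := abs_le.1 (hgE s hs.le)
  have h2 := abs_le.1 (hgE t (hs.le.trans hst))
  have hexp : Real.exp (-(t - s)) ≤ 1 := Real.exp_le_one_iff.2 (by linarith)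
  have hexp0 := Real.exp_pos (-(t - s))
  have hK3' : 0 ≤ K3 := by positivity
  have h3 : F s - K3 ≤ E s + (L * K2) ^ 2 := by
    have := hE0 s
    simp only [hFdef]
    linarith [h1.2]
  have h4 := mul_le_mul_of_nonneg_left h3 hexp0.le
  have h5 := mul_le_mul_of_nonneg_right hexp (sq_nonneg (L * K2))
  have h6 : 1 / 4 * E t ≤ F t + (L * K2) ^ 2 := by
    simp only [hFdef]
    linarith [h2.1, hE0 t]
  linarith

/-- The absorbing set, in terms of the Fourier coefficients. -/
lemma exists_absorbing {ε : ℝ} (δ β : ℝ) (hε : 0 < ε) :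
    ∃ C : ℝ, 0 ≤ C ∧ ∀ M : ℝ, 0 ≤ M → ∃ T : ℝ, ∀ a, ModeSystem ε δ β a →
      (∀ ξ, a 0 (reflect ξ) = -a 0 ξ) → ∑' ξ, ‖a 0 ξ‖ ^ 2 ≤ M →
        ∀ t, T ≤ t → ∀ ξ, ‖a t ξ‖ ^ 2 ≤ C * (wt ξ ^ 5)⁻¹ := by
  obtain ⟨K, hK, henergy⟩ := exists_energy_decay (ε := ε) δ β hε
  obtain ⟨C, hC, hdec⟩ := exists_decay_of_energy_le (ε := ε) δ β hε (τ := 1) (R := 1 + K)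
    one_pos (by linarith)
  refine ⟨C, hC, fun M hM => ⟨1 + 4 * (2 + 2 * M) + 3, fun a h hodd hM0 t ht ξ => ?_⟩⟩
  obtain ⟨s, hs, hs1, hsE⟩ := h.exists_time_energy_le
  refine hdec a h (1 + 4 * (2 + 2 * M)) t (by positivity) (fun r hr => ?_) t
    ⟨by linarith, le_rfl⟩ ξ
  have hx : 4 * (2 + 2 * M) ≤ r - s := by linarith [hr.1]
  refine (henergy a h (fun q hq => h.odd hε hodd hq) s r hs (by linarith)).trans ?_
  have h1 : Real.exp (-(r - s)) * (4 * (2 + 2 * M)) ≤ 1 := by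
    rw [Real.exp_neg, inv_mul_le_one₀ (Real.exp_pos _)]
    linarith [Real.add_one_le_exp (r - s)]
  have h2 : ∑' ξ, ‖a s ξ‖ ^ 2 ≤ 2 + 2 * M := by linarith
  have h3 := mul_le_mul_of_nonneg_left h2 (Real.exp_pos (-(r - s))).le
  linarith

end ModeSystem

/-! ### Fourier series on the torus -/

/-- The character `(x, y) ↦ e^{i ξ₁ x + i ξ₂ y}`. -/
def trigChar (ξ : ℤ × ℤ) : C(Torus, ℂ) where
  toFun z := fourier ξ.1 z.1 * fourier ξ.2 z.2
  continuous_toFun := by fun_prop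

lemma trigChar_apply (ξ : ℤ × ℤ) (z : Torus) : trigChar ξ z = fourier ξ.1 z.1 * fourier ξ.2 z.2 :=
  rfl

lemma trigChar_add (ξ μ : ℤ × ℤ) : trigChar (ξ + μ) = trigChar ξ * trigChar μ := by
  ext z
  simp only [trigChar_apply, ContinuousMap.mul_apply, Prod.fst_add, Prod.snd_add, fourier_add]
  ring

lemma trigChar_zero : trigChar 0 = 1 := by
  ext z; simp [trigChar_apply]

lemma trigChar_neg_apply (ξ : ℤ × ℤ) (z : Torus) :
    trigChar (-ξ) z = starRingEnd ℂ (trigChar ξ z) := by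
  simp [trigChar_apply]

lemma norm_trigChar_apply (ξ : ℤ × ℤ) (z : Torus) : ‖trigChar ξ z‖ = 1 := by
  rw [trigChar_apply, norm_mul, fourier_apply, fourier_apply, Circle.norm_coe, Circle.norm_coe,
    one_mul]

/-- The characters span a dense subspace of the continuous functions, by Stone–Weierstrass. -/
lemma span_trigChar_topologicalClosure :
    (Submodule.span ℂ (Set.range trigChar)).topologicalClosure = ⊤ := by
  let A : StarSubalgebra ℂ C(Torus, ℂ) :=
    { toSubalgebra := Algebra.adjoin ℂ (Set.range trigChar)
      star_mem' := by
        change Algebra.adjoin ℂ (Set.range trigChar) ≤ star (Algebra.adjoin ℂ (Set.range trigChar))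
        refine Algebra.adjoin_le ?_
        rintro _ ⟨n, rfl⟩
        refine Algebra.subset_adjoin ⟨-n, ?_⟩
        ext1 z
        simp only [trigChar_neg_apply, starRingEnd_apply, ContinuousMap.star_apply] }
  have hA : Subalgebra.toSubmodule A.toSubalgebra = Submodule.span ℂ (Set.range trigChar) := by
    apply Algebra.adjoin_eq_span_of_subset
    refine .trans (fun x ↦ Submonoid.closure_induction (fun _ ↦ id) ⟨0, trigChar_zero⟩ ?_)
      Submodule.subset_span
    rintro _ _ _ _ ⟨m, rfl⟩ ⟨n, rfl⟩
    exact ⟨m + n, trigChar_add m n⟩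
  have hsep : A.SeparatesPoints := by
    intro x y hxy
    have hinj := AddCircle.injective_toCircle (T := 2 * Real.pi) Real.two_pi_pos.ne'
    by_cases h1 : x.1 = y.1
    · have h2 : x.2 ≠ y.2 := fun h2 => hxy (Prod.ext h1 h2)
      refine ⟨_, ⟨trigChar (0, 1), Algebra.subset_adjoin ⟨(0, 1), rfl⟩, rfl⟩, ?_⟩
      simp only [trigChar_apply, fourier_zero, one_mul, fourier_one]
      exact fun h => h2 (hinj (Subtype.coe_injective h))
    · refine ⟨_, ⟨trigChar (1, 0), Algebra.subset_adjoin ⟨(1, 0), rfl⟩, rfl⟩, ?_⟩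
      simp only [trigChar_apply, fourier_zero, mul_one, fourier_one]
      exact fun h => h1 (hinj (Subtype.coe_injective h))
  rw [← hA]
  exact congr_arg (Subalgebra.toSubmodule <| StarSubalgebra.toSubalgebra ·)
    (ContinuousMap.starSubalgebra_topologicalClosure_eq_top_of_separatesPoints A hsep)

/-- A square integrable function all of whose Fourier coefficients vanish is zero. -/
lemma ae_eq_zero_of_integral_trigChar {f : Torus → ℂ} (hf : MemLp f 2 volume)
    (h : ∀ ξ, ∫ z, trigChar (-ξ) z * f z = 0) : f =ᵐ[volume] 0 := by
  have hd : (Submodule.span ℂ (Set.range fun ξ =>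
      ContinuousMap.toLp (E := ℂ) 2 (volume : Measure Torus) ℂ (trigChar ξ))).topologicalClosure =
        ⊤ := by
    convert! (ContinuousMap.toLp_denseRange ℂ
      (volume : Measure Torus) ℂ (p := 2) (by norm_num)).topologicalClosure_map_submodule
      span_trigChar_topologicalClosure using 1
    erw [Submodule.map_span, Set.range_comp']
    rfl
  have hz : hf.toLp f = 0 := by
    have hmem : hf.toLp f ∈ (Submodule.span ℂ (Set.range fun ξ =>
        ContinuousMap.toLp (E := ℂ) 2 (volume : Measure Torus) ℂ (trigChar ξ)))ᗮ := by
      rw [Submodule.mem_orthogonal]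
      intro u hu
      induction hu using Submodule.span_induction with
      | mem x hx =>
        obtain ⟨ξ, rfl⟩ := hx
        rw [L2.inner_def, ← h ξ]
        refine integral_congr_ae ?_
        filter_upwards [hf.coeFn_toLp, ContinuousMap.coeFn_toLp (p := 2) (𝕜 := ℂ)
          (volume : Measure Torus) (trigChar ξ)] with z h1 h2
        rw [h1, h2, trigChar_neg_apply, RCLike.inner_apply, mul_comm]
      | zero => simp
      | add x y _ _ hx hy => rw [inner_add_left, hx, hy, add_zero]
      | smul c x _ hx => rw [inner_smul_left, hx, mul_zero]
    rwa [Submodule.topologicalClosure_eq_top_iff.1 hd, Submodule.mem_bot] at hmem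
  exact hf.coeFn_toLp.symm.trans ((Lp.eq_zero_iff_ae_eq_zero).1 hz)

lemma integral_trigChar (ξ : ℤ × ℤ) :
    ∫ z : Torus, trigChar ξ z = if ξ = 0 then ((2 * Real.pi) ^ 2 : ℂ) else 0 := by
  have h1 : ∀ n : ℤ, ∫ x : AddCircle (2 * Real.pi), (fourier n x : ℂ) =
      if n = 0 then (2 * Real.pi : ℂ) else 0 := fun n => by
    have h := fourierCoeff_fourier (T := 2 * Real.pi) n
    have h2 := congr_fun h 0
    simp only [fourierCoeff, neg_zero, fourier_zero, one_smul] at h2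
    rw [AddCircle.integral_haarAddCircle, Complex.real_smul, Pi.single_apply] at h2
    have hpi : ((2 * Real.pi : ℝ) : ℂ) ≠ 0 := by exact_mod_cast Real.two_pi_pos.ne'
    rw [Complex.ofReal_inv, inv_mul_eq_iff_eq_mul₀ hpi] at h2
    rw [h2]
    by_cases hn : n = 0
    · simp [hn]
    · simp [hn, Ne.symm hn]
  have h2 : ∫ z : Torus, trigChar ξ z = (∫ x : AddCircle (2 * Real.pi), (fourier ξ.1 x : ℂ)) *
      ∫ y : AddCircle (2 * Real.pi), (fourier ξ.2 y : ℂ) :=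
    integral_prod_mul (μ := volume) (ν := volume) (fun x => (fourier ξ.1 x : ℂ))
      fun y => (fourier ξ.2 y : ℂ)
  rw [h2, h1, h1]
  by_cases hx : ξ.1 = 0 <;> by_cases hy : ξ.2 = 0 <;> simp [hx, hy, Prod.ext_iff, sq]

lemma fourierCoef_eq (u : Torus → ℝ) (ξ : ℤ × ℤ) :
    fourierCoef u ξ = ((2 * Real.pi) ^ 2 : ℂ)⁻¹ * ∫ z, trigChar (-ξ) z * (u z : ℂ) := by
  rw [fourierCoef]
  push_cast
  rfl

lemma integral_trigChar_mul (u : Torus → ℝ) (ξ : ℤ × ℤ) :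
    ∫ z, trigChar (-ξ) z * (u z : ℂ) = (2 * Real.pi) ^ 2 * fourierCoef u ξ := by
  rw [fourierCoef_eq, mul_inv_cancel_left₀]
  exact pow_ne_zero 2 (by exact_mod_cast Real.two_pi_pos.ne')

lemma fourierCoef_congr {u v : Torus → ℝ} (h : u =ᵐ[volume] v) (ξ : ℤ × ℤ) :
    fourierCoef u ξ = fourierCoef v ξ := by
  rw [fourierCoef_eq, fourierCoef_eq]
  congr 1
  exact integral_congr_ae (h.mono fun z hz => by simp only [hz])

lemma fourierCoef_neg (u : Torus → ℝ) (ξ : ℤ × ℤ) :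
    fourierCoef u (-ξ) = starRingEnd ℂ (fourierCoef u ξ) := by
  rw [fourierCoef_eq, fourierCoef_eq, map_mul, ← integral_conj]
  congr 1
  · have h : ((2 * Real.pi) ^ 2 : ℂ) = (((2 * Real.pi) ^ 2 : ℝ) : ℂ) := by push_cast; rfl
    rw [h, ← Complex.ofReal_inv, Complex.conj_ofReal]
  · refine integral_congr_ae (ae_of_all _ fun z => ?_)
    simp only [map_mul, ← trigChar_neg_apply, Complex.conj_ofReal]

lemma integrable_trigChar_mul {f : Torus → ℂ} (hf : Integrable f) (ξ : ℤ × ℤ) :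
    Integrable fun z => trigChar ξ z * f z :=
  hf.bdd_mul (trigChar ξ).continuous.aestronglyMeasurable
    (ae_of_all _ fun z => (norm_trigChar_apply ξ z).le)

lemma integrable_trigChar_mul_ofReal {u : Torus → ℝ} (hu : MemLp u 2 volume) (ξ : ℤ × ℤ) :
    Integrable fun z => trigChar ξ z * (u z : ℂ) :=
  integrable_trigChar_mul (hu.integrable (by norm_num)).ofReal ξ

lemma fourierCoef_sub {u v : Torus → ℝ} (hu : MemLp u 2 volume) (hv : MemLp v 2 volume)
    (ξ : ℤ × ℤ) : fourierCoef (u - v) ξ = fourierCoef u ξ - fourierCoef v ξ := by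
  have hu' := integrable_trigChar_mul_ofReal hu (-ξ)
  have hv' := integrable_trigChar_mul_ofReal hv (-ξ)
  rw [fourierCoef_eq, fourierCoef_eq, fourierCoef_eq, ← mul_sub, ← integral_sub hu' hv']
  congr 1
  refine integral_congr_ae (ae_of_all _ fun z => ?_)
  simp only [Pi.sub_apply]
  push_cast
  ring

lemma fourierCoef_reflect {u : Torus → ℝ} (h : ∀ᵐ z : Torus, u (-z.1, z.2) = -u z)
    (ξ : ℤ × ℤ) : fourierCoef u (reflect ξ) = -fourierCoef u ξ := by
  have hmp : MeasurePreserving (fun z : Torus => (-z.1, z.2)) volume volume :=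
    (Measure.measurePreserving_neg (volume : Measure (AddCircle (2 * Real.pi)))).prod
      (MeasurePreserving.id _)
  have hemb : MeasurableEmbedding (fun z : Torus => (-z.1, z.2)) :=
    ((MeasurableEquiv.neg _).prodCongr (MeasurableEquiv.refl _)).measurableEmbedding
  rw [fourierCoef_eq, fourierCoef_eq, ← mul_neg, ← integral_neg,
    ← hmp.integral_comp hemb (fun z => trigChar (-reflect ξ) z * (u z : ℂ))]
  congr 1
  refine integral_congr_ae (h.mono fun z hz => ?_)
  simp only [hz, trigChar_apply, Prod.fst_neg, Prod.snd_neg, reflect_fst, reflect_snd, neg_neg]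
  rw [fourier_apply, fourier_apply (n := -ξ.1), smul_neg, neg_smul]
  push_cast
  ring

/-- Integration of an absolutely convergent trigonometric series against an integrable function. -/
lemma hasSum_integral_mul_trigChar {c : ℤ × ℤ → ℂ} (hc : Summable fun ξ => ‖c ξ‖) {g : Torus → ℂ}
    (hg : Integrable g) : HasSum (fun μ => c μ * ∫ z, trigChar μ z * g z)
      (∫ z, (∑' μ, c μ * trigChar μ z) * g z) := by
  have hint : ∀ μ, Integrable fun z => c μ * (trigChar μ z * g z) := fun μ =>
    (integrable_trigChar_mul hg μ).const_mul _
  have hs : Summable fun μ => ∫ z, ‖c μ * (trigChar μ z * g z)‖ := by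
    refine (hc.mul_right (∫ z, ‖g z‖)).congr fun μ => ?_
    rw [← integral_const_mul]
    refine integral_congr_ae (ae_of_all _ fun z => ?_)
    simp only [norm_mul, norm_trigChar_apply, one_mul]
  have h := hasSum_integral_of_summable_integral_norm hint hs
  simp only [integral_const_mul] at h
  convert! h using 1
  refine integral_congr_ae (ae_of_all _ fun z => ?_)
  simp only
  rw [← tsum_mul_right]
  exact tsum_congr fun μ => by ring

/-- A square integrable function with absolutely summable Fourier coefficients is the sum of its
Fourier series. -/
lemma ae_eq_tsum_trigChar {u : Torus → ℝ} (hu : MemLp u 2 volume)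
    (hs : Summable fun ξ => ‖fourierCoef u ξ‖) :
    ∀ᵐ z : Torus, (u z : ℂ) = ∑' μ, fourierCoef u μ * trigChar μ z := by
  have hcont : Continuous fun z : Torus => ∑' μ, fourierCoef u μ * trigChar μ z := by
    refine continuous_tsum (fun μ => by fun_prop) hs fun μ z => ?_
    rw [norm_mul, norm_trigChar_apply, mul_one]
  have hv : MemLp (fun z : Torus => ∑' μ, fourierCoef u μ * trigChar μ z) 2 volume :=
    MemLp.of_bound hcont.aestronglyMeasurable (∑' μ, ‖fourierCoef u μ‖) (ae_of_all _ fun z => by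
      refine tsum_of_norm_bounded hs.hasSum fun μ => ?_
      rw [norm_mul, norm_trigChar_apply, mul_one])
  have hdiff := ae_eq_zero_of_integral_trigChar (hu.ofReal.sub hv) fun ξ => by
    have h1 := integrable_trigChar_mul_ofReal hu (-ξ)
    have h2 := integrable_trigChar_mul (hv.integrable (by norm_num)) (-ξ)
    have h3 := hasSum_integral_mul_trigChar hs
      (g := trigChar (-ξ)) ((trigChar (-ξ)).continuous.integrable_of_hasCompactSupport
        (HasCompactSupport.of_compactSpace _))
    have h4 : ∀ μ, ∫ z : Torus, trigChar μ z * trigChar (-ξ) z =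
        if μ = ξ then ((2 * Real.pi) ^ 2 : ℂ) else 0 := fun μ => by
      have := integral_trigChar (μ + -ξ)
      simp only [trigChar_add, ContinuousMap.mul_apply, add_neg_eq_zero] at this
      exact this
    simp only [h4, mul_ite, mul_zero] at h3
    have h5 := h3.unique (hasSum_single ξ fun μ hμ => if_neg hμ)
    rw [if_pos rfl] at h5
    simp only [Pi.sub_apply, mul_sub]
    refine (integral_sub h1 h2).trans ?_
    rw [integral_trigChar_mul, mul_comm, ← h5, sub_eq_zero]
    exact integral_congr_ae (ae_of_all _ fun z => mul_comm _ _)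
  filter_upwards [hdiff] with z hz
  exact sub_eq_zero.1 hz

/-- The convolution theorem for the square of a function with absolutely summable Fourier
coefficients. -/
lemma fourierCoef_half_sq {u : Torus → ℝ} (hu : MemLp u 2 volume)
    (hs : Summable fun ξ => ‖fourierCoef u ξ‖) (ξ : ℤ × ℤ) :
    fourierCoef (fun z => u z ^ 2 / 2) ξ = halfSq (fourierCoef u) ξ := by
  have hint := integrable_trigChar_mul_ofReal hu (-ξ)
  have h1 := hasSum_integral_mul_trigChar hs hint
  have h2 : ∀ μ, ∫ z, trigChar μ z * (trigChar (-ξ) z * (u z : ℂ)) =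
      (2 * Real.pi) ^ 2 * fourierCoef u (ξ - μ) := fun μ => by
    rw [← integral_trigChar_mul]
    refine integral_congr_ae (ae_of_all _ fun z => ?_)
    simp only
    rw [show -(ξ - μ) = μ + -ξ by abel, trigChar_add, ContinuousMap.mul_apply, mul_assoc]
  have hpi : ((2 * Real.pi) ^ 2 : ℂ) ≠ 0 := pow_ne_zero 2 (by exact_mod_cast Real.two_pi_pos.ne')
  have h3 : ∫ z, trigChar (-ξ) z * ((u z ^ 2 / 2 : ℝ) : ℂ) =
      1 / 2 * ∫ z, (∑' μ, fourierCoef u μ * trigChar μ z) * (trigChar (-ξ) z * (u z : ℂ)) := by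
    rw [← integral_const_mul]
    refine integral_congr_ae ((ae_eq_tsum_trigChar hu hs).mono fun z hz => ?_)
    simp only [← hz]
    push_cast
    ring
  rw [fourierCoef_eq, h3, ← h1.tsum_eq, halfSq]
  simp_rw [h2, mul_left_comm _ ((2 * Real.pi) ^ 2 : ℂ), tsum_mul_left]
  field_simp

/-! ### From Sobolev norms to Fourier coefficients -/

lemma ofReal_wt_mul (s : ℕ) (u : Torus → ℝ) (ξ : ℤ × ℤ) :
    ENNReal.ofReal ((1 + freqSq ξ) ^ s) * ‖fourierCoef u ξ‖ₑ ^ 2 =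
      ENNReal.ofReal (wt ξ ^ s * ‖fourierCoef u ξ‖ ^ 2) := by
  rw [← ofReal_norm, ← ENNReal.ofReal_pow (norm_nonneg _),
    ← wt,
    ← ENNReal.ofReal_mul (pow_nonneg (wt_pos ξ).le s)]

lemma sobolevNorm_sq (s : ℕ) (u : Torus → ℝ) :
    sobolevNorm s u ^ 2 = ENNReal.ofReal ((2 * Real.pi) ^ 2) *
      ∑' ξ, ENNReal.ofReal (wt ξ ^ s * ‖fourierCoef u ξ‖ ^ 2) := by
  simp only [sobolevNorm, ofReal_wt_mul]
  rw [← ENNReal.rpow_natCast, ← ENNReal.rpow_mul]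
  norm_num

lemma tsum_wt_le_sobolevNorm_sq (s : ℕ) (u : Torus → ℝ) :
    ∑' ξ, ENNReal.ofReal (wt ξ ^ s * ‖fourierCoef u ξ‖ ^ 2) ≤ sobolevNorm s u ^ 2 := by
  rw [sobolevNorm_sq]
  refine le_mul_of_one_le_left' (ENNReal.one_le_ofReal.2 (one_le_pow₀ ?_))
  linarith [Real.two_le_pi]

lemma summable_of_sobolevNorm_lt_top {s : ℕ} {u : Torus → ℝ} (h : sobolevNorm s u < ∞) :
    Summable fun ξ => wt ξ ^ s * ‖fourierCoef u ξ‖ ^ 2 := by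
  have h1 : ∑' ξ, ENNReal.ofReal (wt ξ ^ s * ‖fourierCoef u ξ‖ ^ 2) ≠ ∞ :=
    ((tsum_wt_le_sobolevNorm_sq s u).trans_lt (ENNReal.pow_lt_top h)).ne
  refine (ENNReal.summable_toReal h1).congr fun ξ => ?_
  exact ENNReal.toReal_ofReal (mul_nonneg (pow_nonneg (wt_pos ξ).le s) (by positivity))

lemma ofReal_tsum_le_sobolevNorm_sq {s : ℕ} {u : Torus → ℝ} (h : sobolevNorm s u < ∞) :
    ENNReal.ofReal (∑' ξ, wt ξ ^ s * ‖fourierCoef u ξ‖ ^ 2) ≤ sobolevNorm s u ^ 2 := by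
  rw [ENNReal.ofReal_tsum_of_nonneg
    (fun ξ => mul_nonneg (pow_nonneg (wt_pos ξ).le s) (by positivity))
    (summable_of_sobolevNorm_lt_top h)]
  exact tsum_wt_le_sobolevNorm_sq s u

lemma sobolevNorm_mono {s s' : ℕ} (h : s ≤ s') (u : Torus → ℝ) :
    sobolevNorm s u ≤ sobolevNorm s' u := by
  refine ENNReal.rpow_le_rpow (mul_le_mul_right (ENNReal.tsum_le_tsum fun ξ => ?_) _)
    (by norm_num)
  refine mul_le_mul_left (ENNReal.ofReal_le_ofReal ?_) _
  exact pow_le_pow_right₀ (one_le_wt ξ) h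

/-- Decay of order `5` of the Fourier coefficients gives an explicit bound of the `H²` norm. -/
lemma exists_sobolevNorm_le (C : ℝ) (hC : 0 ≤ C) : ∃ R : ℝ≥0, ∀ u : Torus → ℝ,
    (∀ ξ, ‖fourierCoef u ξ‖ ^ 2 ≤ C * (wt ξ ^ 5)⁻¹) → sobolevNorm 2 u ≤ R := by
  set B := ENNReal.ofReal ((2 * Real.pi) ^ 2) * ENNReal.ofReal (∑' ξ, C * (wt ξ ^ 3)⁻¹)
  have hB : B ≠ ∞ := ENNReal.mul_ne_top ENNReal.ofReal_ne_top ENNReal.ofReal_ne_top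
  refine ⟨(B ^ (1 / 2 : ℝ)).toNNReal, fun u hu => ?_⟩
  rw [ENNReal.coe_toNNReal (ENNReal.rpow_ne_top_of_nonneg (by norm_num) hB)]
  refine ENNReal.rpow_le_rpow (mul_le_mul_right ?_ _) (by norm_num)
  rw [ENNReal.ofReal_tsum_of_nonneg (fun ξ => by have := wt_pos ξ; positivity)
    ((summable_inv_wt_pow (by norm_num)).mul_left C)]
  refine ENNReal.tsum_le_tsum fun ξ => ?_
  rw [ofReal_wt_mul]
  refine ENNReal.ofReal_le_ofReal ?_
  have hw := wt_pos ξ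
  refine (mul_le_mul_of_nonneg_left (hu ξ) (by positivity)).trans_eq ?_
  field_simp

lemma IsSolution.modeSystem {ε δ β : ℝ} {η₀ : Torus → ℝ} {η : ℝ → Torus → ℝ}
    (h : IsSolution ε δ β η₀ η) : ModeSystem ε δ β fun t => fourierCoef (η t) where
  conj_neg t _ ξ := fourierCoef_neg (η t) ξ
  summable t ht := summable_of_sobolevNorm_lt_top (h.mem_H2 t ht).2
  tendsto t ht := by
    have h1 : Tendsto (fun s => (sobolevNorm 2 (η s - η t) ^ 2).toReal) (𝓝[Set.Ici 0] t) (𝓝 0) := by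
      have h2 := (ENNReal.continuous_pow 2).tendsto 0 |>.comp (h.continuous_H2 t ht)
      rw [zero_pow two_ne_zero] at h2
      exact (ENNReal.tendsto_toReal ENNReal.zero_ne_top).comp h2
    refine squeeze_zero' (Eventually.of_forall fun s => tsum_nonneg fun ξ => by positivity) ?_ h1
    have h3 := (h.continuous_H2 t ht).eventually (gt_mem_nhds ENNReal.zero_lt_top)
    filter_upwards [h3, self_mem_nhdsWithin] with s hs hs0
    have h4 := ofReal_tsum_le_sobolevNorm_sq hs
    have h5 := (ENNReal.ofReal_le_iff_le_toReal (ENNReal.pow_lt_top hs).ne).1 h4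
    simpa only [fourierCoef_sub (h.mem_H2 s hs0).1 (h.mem_H2 t ht).1] using h5
  ode ξ t ht := by
    have hm := h.mem_H2 t ht.le
    have hs := (ModeSystem.summable_of_wt (summable_of_sobolevNorm_lt_top hm.2)).1
    have := h.equation ξ t ht
    rwa [fourierCoef_half_sq hm.1 hs] at this

end NonlocalKS

end

theorem mainTheorem3 (ε δ β : ℝ) (hε : 0 < ε) (hδ : 0 ≤ δ) (hβ : 0 < β) :
    ∃ R₁ R₂ : ℝ≥0,
      (∀ (η₀ : NonlocalKS.Torus → ℝ) (η : ℝ → NonlocalKS.Torus → ℝ),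
        NonlocalKS.MemH2Odd η₀ → NonlocalKS.IsSolution ε δ β η₀ η →
          limsup (fun t : ℝ => NonlocalKS.sobolevNorm 2 (η t)) atTop ≤ (R₂ : ℝ≥0∞)) ∧
      NonlocalKS.BallIsAbsorbing ε δ β 1 R₁ ∧
      NonlocalKS.BallIsAbsorbing ε δ β 2 R₂ := by
  open NonlocalKS in
  obtain ⟨C, hC, habs⟩ := ModeSystem.exists_absorbing (ε := ε) δ β hε
  obtain ⟨R, hR⟩ := exists_sobolevNorm_le C hC
  -- data bounded in any `H^s` are bounded in `L²`, and so they reach the same ball of `H²`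
  have key : ∀ (s : ℕ) (M : ℝ≥0), ∃ T : ℝ, ∀ (η₀ : Torus → ℝ) (η : ℝ → Torus → ℝ),
      MemH2Odd η₀ → IsSolution ε δ β η₀ η → sobolevNorm s η₀ ≤ M →
        ∀ t : ℝ, T ≤ t → sobolevNorm 2 (η t) ≤ R := fun s M => by
    obtain ⟨T, hT⟩ := habs ((M : ℝ) ^ 2) (by positivity)
    refine ⟨T, fun η₀ η hodd hsol hM t ht => hR _ fun ξ => ?_⟩
    have hc : ∀ ξ, fourierCoef (η 0) ξ = fourierCoef η₀ ξ := fourierCoef_congr hsol.initial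
    refine hT _ hsol.modeSystem (fun ξ => ?_) ?_ t ht ξ
    · simp only [hc]
      exact fourierCoef_reflect hodd.2 ξ
    · have h0 : sobolevNorm 0 η₀ ≤ M := (sobolevNorm_mono (Nat.zero_le s) η₀).trans hM
      have h1 := ofReal_tsum_le_sobolevNorm_sq (h0.trans_lt ENNReal.coe_lt_top)
      have h2 := h1.trans (pow_le_pow_left₀ zero_le h0 2)
      rw [← ENNReal.coe_pow, ← ENNReal.ofReal_coe_nnreal,
        ENNReal.ofReal_le_ofReal_iff (by positivity)] at h2
      simpa [hc] using h2
  refine ⟨R, R, fun η₀ η hodd hsol => ?_, fun M => ?_, fun M => ?_⟩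
  · obtain ⟨T, hT⟩ := key 2 (sobolevNorm 2 η₀).toNNReal
    refine limsup_le_of_le (by isBoundedDefault) ?_
    filter_upwards [eventually_ge_atTop T] with t ht
    exact hT η₀ η hodd hsol (ENNReal.coe_toNNReal hodd.1.2.ne).ge t ht
  · obtain ⟨T, hT⟩ := key 1 M
    exact ⟨T, fun η₀ η hodd hsol hM t _ ht =>
      (sobolevNorm_mono one_le_two _).trans (hT η₀ η hodd hsol hM t ht)⟩
  · obtain ⟨T, hT⟩ := key 2 M
    exact ⟨T, fun η₀ η hodd hsol hM t _ ht => hT η₀ η hodd hsol hM t ht⟩
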